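/- **Setting.** Let $\lambda\in\mathbb Z_{\ge 0}$ and let $U(\mathfrak{osp}(1|2))$ be the enveloping superalgebra of $\mathfrak{osp}(1|2)$, with even basis elements $X,Y,H$ and odd basis elements $F,G$, where $[H,X]=2X$, $[H,Y]=-2Y$, $[X,Y]=H$, $[H,F]=-F$, $[H,G]=G$, $[G,Y]=F$, $[F,X]=G$, $[G,F]=H$, $[G,G]=2X$, $[F,F]=-2Y$ and the remaining brackets of basis elements vanish. Put $$\tau=H+\tfrac12-2FG,\qquad U=F,\qquad V=\left(\tau-H+\tfrac12\right)G .$$ Let $\mathfrak m_\lambda$ be the kernel of the representation with basis $e_0,\dots,e_{2\lambda}$ ($e_a$ of parity $a \bmod 2$) given by $He_a=(\lambda-a)e_a$, $Fe_a=e_{a+1}$ (with $e_{2\lambda+1}=0$), $Ge_a=c_ae_{a-1}$, $c_{2b}=-b$, $c_{2b+1}=\lambda-b$, and let $\mathfrak B_\lambda=U(\mathfrak{osp}(1|2))/\mathfrak m_\lambda$. **Structure.** The vector $e_0$ is a highest weight vector of weight $\lambda$, and this representation induces an isomorphism of superalgebras $\mathfrak B_\lambda\simeq\mathrm{Mat}(\lambda+1|\lambda)$.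 The images of $U,V,H$ generate $\mathfrak B_\lambda$ and satisfy $$HU-UH=-U,\quad HV-VH=V,\quad VU=\tfrac12(\lambda(\lambda+1)-H^2+H),\quad UV=\tfrac12(\lambda(\lambda+1)-H^2-H), \tag{R}$$ and every $H-(n+\frac12)$ with $n\in\mathbb Z$ is invertible in $\mathfrak B_\lambda$. A suitable supertransposition $u\mapsto u^t$ of $\mathfrak B_\lambda$ satisfies $(uv)^t=(-1)^{p(u)p(v)}v^tu^t$ for homogeneous $u,v$, and $H^t=H$, $U^t=-V$, $V^t=U$. Put $\langle u,v\rangle=\mathrm{str}(uv^t)$ and $(\mathfrak B_\lambda)_i=\{u\mid [H,u]=iu\}$; for $f,g\in\mathbb C[H]$ and $j\ge 0$ put $$\langle f,g\rangle_j=\langle fV^j,gV^j\rangle,\qquad \langle f,g\rangle_{-j}=\langle fU^j,gU^j\rangle .$$ **The polynomials $f_{l,j}$.** Write $[u,v]=uv-(-1)^{p(u)p(v)}vu$ and $\{u,v\}=uv-(-1)^{p(u)(p(v)+1)}vu$, where $U,V$ are odd and $H$ is even. For $i\ge0$ set * $f_{0,2i}V^{2i}=V^{2i}$, $\ f_{2,2i}V^{2i}=[U,V^{2i+1}]$,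 and $f_{2k,2i}V^{2i}=\bigl[U,\frac1{H-(i+1/2)}[U,f_{2k-2,2i+2}V^{2i+2}]\bigr]$ for $k\ge2$; * $f_{1,2i}V^{2i}=\{U,V^{2i+1}\}$, and $f_{2k+1,2i}V^{2i}=\bigl\{U,\frac1{H-(i+1/2)}\{U,f_{2k-1,2i+2}V^{2i+2}\}\bigr\}$ for $k\ge1$; * $f_{0,2i+1}V^{2i+1}=V^{2i+1}$, and $f_{2k,2i+1}V^{2i+1}=\frac1{H-(i+1/2)}[U,f_{2k,2i+2}V^{2i+2}]$ for $k\ge1$; * $f_{2k+1,2i+1}V^{2i+1}=(H-(i+\frac12))f_{2k,2i+1}V^{2i+1}$ for $k\ge0$. For all $l,j\ge0$ there is exactly one polynomial $f_{l,j}\in\mathbb C[H]$ for which this equation holds in every associative $\mathbb C$-algebra with elements $U,V,H$ that satisfy (R) and for which all $H-(n+\frac12)$, $n\in\mathbb Z$, are invertible (in particular, in $\mathfrak B_\lambda$). **Theorem.** Write $\Delta f(H)=f(H+1)-f(H)$, $\nabla f(H)=f(H)-f(H-1)$, $(a)_n=a(a+1)\cdots(a+n-1)$. Let $i,k,l,m$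 run over $\mathbb Z_{\ge0}$; difference equations are identities of rational functions in $H$. 1. $\langle(\mathfrak B_\lambda)_i,(\mathfrak B_\lambda)_j\rangle=0$ for integers $i\ne j$. 2. The $f_{l,2i}$, $l\ge0$, are orthogonal polynomials for $\langle\cdot,\cdot\rangle_{2i}$: $\deg f_{l,2i}=l$ and $f_{l,2i}$ is orthogonal to every polynomial of degree $<l$. Moreover $\langle f_{l,2i},f_{l,2i}\rangle_{2i}\ne0$ exactly when $l+2i\le2\lambda$. 3. $f=f_{2k,2i}$ satisfies $$\frac{(H-\lambda)(H+\lambda+1)}{2H-2i+1}\Delta f+\frac{(H-2i-\lambda-1)(H-2i+\lambda)}{2H-2i-1}\nabla f=2kf .$$ 4. $f=f_{2k+1,2i}$ satisfies $$\frac{(H-\lambda)(H+\lambda+1)}{2H-2i+1}\Delta f+\frac{(H-2i-\lambda-1)(H-2i+\lambda)}{2H-2i-1}\nabla f+\frac{(\lambda+\frac12)^2-i^2}{(H-i)^2-\frac14}f=(2k+1)f .$$ 5. The $f_{l,2i}(-H)$, $l\ge0$, are orthogonal polynomials (in the sense of 2, with $\deg f_{l,2i}(-H)=l$) for $\langle\cdot,\cdot\rangle_{-2i}$,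 and the norm of $f_{l,2i}(-H)$ is nonzero exactly when $l+2i\le2\lambda$. 6. $\deg f_{l,2i+1}=l$, and $\langle f_{l,2i+1},f_{m,2i+1}\rangle_{2i+1}\ne0$ if and only if $\{l,m\}=\{2k,2k+1\}$ for some $k$ with $k+i+1\le\lambda$. 7. $\deg f_{l,2i+1}(-H)=l$, and $\langle f_{l,2i+1}(-H),f_{m,2i+1}(-H)\rangle_{-(2i+1)}\ne0$ if and only if $\{l,m\}=\{2k,2k+1\}$ for some $k$ with $k+i+1\le\lambda$. 8. $f=f_{2k,2i+1}$ satisfies $$\frac{(H-\lambda)(H+\lambda+1)}{2H-2i-1}\Delta f+\frac{(H-2i-1+\lambda)(H-2i-2-\lambda)}{2H-2i-1}\nabla f=2kf .$$ 9. $f_{0,2i}=1$; and for $k\ge1$ with $k+i\le\lambda$, $f_{2k,2i}$ is the dual Hahn polynomial $$f_{2k,2i}(H)=-(2i+k+1)_{k-1}\,(\lambda+i+1)_k\,(i-\lambda)_k\;{}_3F_2\!\left(\left.\begin{matrix}-k,\ i-H,\ H-i\\ \lambda+i+1,\ i-\lambda\end{matrix}\right|\,1\right).$$ For every $k\ge1$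 (without $k+i\le\lambda$) the same holds with the lower parameters cleared: $$f_{2k,2i}(H)=-(2i+k+1)_{k-1}\sum_{n=0}^{k}\frac{(-k)_n(i-H)_n(H-i)_n}{n!}\,(\lambda+i+1+n)_{k-n}\,(i-\lambda+n)_{k-n}.$$ -/

import Mathlib

open Polynomial

namespace OspOneTwo

/-! ### The enveloping superalgebra of `osp(1|2)` -/

/-- The standard basis of `osp(1|2)`; `X, Y, H` are even and `F, G` are odd. -/
inductive Gen : Type
  | X | Y | H | F | G

/-- The free associative algebra on the basis of `osp(1|2)`. -/
abbrev Free : Type := FreeAlgebra ℂ Gen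

/-- A basis vector as an element of the free algebra. -/
def gen (g : Gen) : Free := FreeAlgebra.ι ℂ g

/-- The defining relations `x y - (-1)^{p(x)p(y)} y x = [x, y]` of the enveloping superalgebra,
one for each unordered pair of basis vectors. -/
inductive Rel : Free → Free → Prop
  | HX : Rel (gen .H * gen .X - gen .X * gen .H) ((2 : ℂ) • gen .X)
  | HY : Rel (gen .H * gen .Y - gen .Y * gen .H) ((-2 : ℂ) • gen .Y)
  | XY : Rel (gen .X * gen .Y - gen .Y * gen .X) (gen .H)
  | HF : Rel (gen .H * gen .F - gen .F * gen .H) (-gen .F)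
  | HG : Rel (gen .H * gen .G - gen .G * gen .H) (gen .G)
  | GY : Rel (gen .G * gen .Y - gen .Y * gen .G) (gen .F)
  | FX : Rel (gen .F * gen .X - gen .X * gen .F) (gen .G)
  | GX : Rel (gen .G * gen .X - gen .X * gen .G) 0
  | FY : Rel (gen .F * gen .Y - gen .Y * gen .F) 0
  | GF : Rel (gen .G * gen .F + gen .F * gen .G) (gen .H)
  | GG : Rel (gen .G * gen .G + gen .G * gen .G) ((2 : ℂ) • gen .X)
  | FF : Rel (gen .F * gen .F + gen .F * gen .F) ((-2 : ℂ) • gen .Y)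

/-- The enveloping superalgebra `U(osp(1|2))`, as an associative algebra. -/
abbrev Uosp : Type := RingQuot Rel

/-- The image of a basis vector in `U(osp(1|2))`. -/
noncomputable def u (g : Gen) : Uosp := RingQuot.mkAlgHom ℂ Rel (gen g)

/-- `τ = H + 1/2 - 2 F G`. -/
noncomputable def tau : Uosp :=
  u .H + algebraMap ℂ Uosp (1 / 2) - (2 : ℂ) • (u .F * u .G)

/-- `U = F`. -/
noncomputable def elU : Uosp := u .F

/-- `V = (τ - H + 1/2) G`. -/
noncomputable def elV : Uosp := (tau - u .H + algebraMap ℂ Uosp (1 / 2)) * u .G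

/-! ### The irreducible representation with highest weight `lam` -/

/-- The matrix algebra underlying `Mat(lam+1|lam)`. The index `a` has parity `a mod 2`, so that
there are `lam + 1` even and `lam` odd indices; it is the index of a vector of weight `lam - a`. -/
abbrev Mat (lam : ℕ) : Type := Matrix (Fin (2 * lam + 1)) (Fin (2 * lam + 1)) ℂ

/-- `F e_a = e_{a+1}`. -/
def matF (lam : ℕ) : Mat lam := Matrix.of fun a b => if (a : ℕ) = b + 1 then 1 else 0

/-- The coefficient in `G e_a = c_a e_{a-1}`: `c_{2b} = -b`, `c_{2b+1} = lam - b`. -/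
noncomputable def gCoeff (lam a : ℕ) : ℂ :=
  if a % 2 = 0 then -((a / 2 : ℕ) : ℂ) else (lam : ℂ) - ((a / 2 : ℕ) : ℂ)

/-- `G e_a = c_a e_{a-1}`. -/
noncomputable def matG (lam : ℕ) : Mat lam :=
  Matrix.of fun a b => if (a : ℕ) + 1 = b then gCoeff lam b else 0

/-- `H e_a = (lam - a) e_a`. -/
noncomputable def matH (lam : ℕ) : Mat lam := Matrix.diagonal fun a => (lam : ℂ) - ((a : ℕ) : ℂ)

/-- The action of the basis vectors. -/
noncomputable def genMat (lam : ℕ) : Gen → Mat lam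
  | .X => matG lam * matG lam
  | .Y => -(matF lam * matF lam)
  | .H => matH lam
  | .F => matF lam
  | .G => matG lam

theorem matHF (lam : ℕ) : matH lam * matF lam - matF lam * matH lam = -matF lam := by
  ext a b
  simp only [matH, matF, Matrix.sub_apply, Matrix.diagonal_mul, Matrix.mul_diagonal,
    Matrix.of_apply, Matrix.neg_apply]
  split_ifs with h
  · rw [h]; push_cast; ring
  · ring

theorem matHG (lam : ℕ) : matH lam * matG lam - matG lam * matH lam = matG lam := by
  ext a b
  simp only [matH, matG, Matrix.sub_apply, Matrix.diagonal_mul, Matrix.mul_diagonal,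
    Matrix.of_apply]
  split_ifs with h
  · rw [← h]; push_cast; ring
  · ring

theorem matGF (lam : ℕ) : matG lam * matF lam + matF lam * matG lam = matH lam := by
  ext a b
  have hc : ∀ n : ℕ, gCoeff lam (n + 1) + gCoeff lam n = (lam : ℂ) - n := by
    intro n
    obtain ⟨m, rfl | rfl⟩ := Nat.even_or_odd' n
    · have h1 : (2 * m + 1) % 2 ≠ 0 := by omega
      have h2 : (2 * m + 1) / 2 = m := by omega
      simp [gCoeff, h2]; ring
    · have h1 : (2 * m + 1 + 1) % 2 = 0 := by omega
      have h2 : (2 * m + 1) / 2 = m := by omega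
      have h3 : (2 * m + 1 + 1) / 2 = m + 1 := by omega
      have h4 : (2 * m + 1) % 2 ≠ 0 := by omega
      simp only [gCoeff, h1, h2, h3, if_true, if_neg h4]; push_cast; ring
  have h0 : gCoeff lam 0 = 0 := by simp [gCoeff]
  have e1 : (matG lam * matF lam) a b =
      if a = b ∧ (a : ℕ) + 1 < 2 * lam + 1 then gCoeff lam (a + 1) else 0 := by
    simp only [Matrix.mul_apply, matG, matF, Matrix.of_apply]
    split_ifs with h
    · obtain ⟨rfl, h⟩ := h
      rw [Finset.sum_eq_single ⟨(a : ℕ) + 1, h⟩]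
      · simp
      · intro c _ hca
        have : ¬ ((a : ℕ) + 1 = c) := fun h' => hca (Fin.ext h'.symm)
        simp [this]
      · simp
    · refine Finset.sum_eq_zero fun c _ => ?_
      by_cases h1 : (a : ℕ) + 1 = c
      · by_cases h2 : (c : ℕ) = b + 1
        · exact absurd ⟨Fin.ext (by omega), by omega⟩ h
        · simp [h2]
      · simp [h1]
  have e2 : (matF lam * matG lam) a b = if a = b then gCoeff lam a else 0 := by
    simp only [Matrix.mul_apply, matG, matF, Matrix.of_apply]
    split_ifs with h
    · subst h
      by_cases ha : (a : ℕ) = 0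
      · rw [ha, h0]
        refine Finset.sum_eq_zero fun c _ => ?_
        simp
      · rw [Finset.sum_eq_single ⟨(a : ℕ) - 1, by omega⟩]
        · have h1 : (a : ℕ) = a - 1 + 1 := by omega
          simp [← h1]
        · intro c _ hca
          have : ¬ ((a : ℕ) = c + 1) := fun h' => hca (Fin.ext (by simp; omega))
          simp [this]
        · simp
    · refine Finset.sum_eq_zero fun c _ => ?_
      by_cases h1 : (a : ℕ) = c + 1
      · by_cases h2 : (c : ℕ) + 1 = b
        · exact absurd (Fin.ext (by omega)) h
        · simp [h2]
      · simp [h1]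
  rw [Matrix.add_apply, e1, e2, matH, Matrix.diagonal_apply]
  by_cases h : a = b
  · subst h
    by_cases h1 : (a : ℕ) + 1 < 2 * lam + 1
    · simp [h1, ← hc]
    · have ha : (a : ℕ) = 2 * lam := by omega
      simp [ha, gCoeff]; ring
  · simp [h]

theorem genMat_rel (lam : ℕ) ⦃x y : Free⦄ (h : Rel x y) :
    FreeAlgebra.lift ℂ (genMat lam) x = FreeAlgebra.lift ℂ (genMat lam) y := by
  have hf : matH lam * matF lam = matF lam * matH lam - matF lam := by
    rw [sub_eq_add_neg, ← matHF]; abel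
  have hg : matH lam * matG lam = matG lam * matH lam + matG lam := by
    nth_rewrite 3 [← matHG]; abel
  have hgf : matG lam * matF lam = matH lam - matF lam * matG lam := by
    rw [← matGF]; abel
  have hgf' : ∀ z, matG lam * (matF lam * z) = matH lam * z - matF lam * (matG lam * z) := by
    intro z; rw [← mul_assoc, hgf, sub_mul, mul_assoc]
  have hf' : ∀ z, matH lam * (matF lam * z) = matF lam * (matH lam * z) - matF lam * z := by
    intro z; rw [← mul_assoc, hf, sub_mul, mul_assoc]
  have hg' : ∀ z, matH lam * (matG lam * z) = matG lam * (matH lam * z) + matG lam * z := by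
    intro z; rw [← mul_assoc, hg, add_mul, mul_assoc]
  cases h <;>
    simp only [gen, map_sub, map_add, map_mul, map_neg, map_smul, map_zero,
      FreeAlgebra.lift_ι_apply, genMat, mul_assoc, mul_neg, neg_mul, hf, hg, hgf, hf', hg', hgf',
      mul_sub, mul_add] <;>
    module

/-- The representation of `U(osp(1|2))` with highest weight `lam`. The algebra `B_lam` is the
quotient of `U(osp(1|2))` by the kernel of `rho lam`, that is, the image of `rho lam`. -/
noncomputable def rho (lam : ℕ) : Uosp →ₐ[ℂ] Mat lam :=
  RingQuot.liftAlgHom ℂ ⟨FreeAlgebra.lift ℂ (genMat lam), genMat_rel lam⟩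

/-- The image of `U` in `B_lam`. -/
noncomputable def bU (lam : ℕ) : Mat lam := rho lam elU

/-- The image of `V` in `B_lam`. -/
noncomputable def bV (lam : ℕ) : Mat lam := rho lam elV

/-- The image of `H` in `B_lam`. -/
noncomputable def bH (lam : ℕ) : Mat lam := rho lam (u .H)

/-! ### Superstructure on `Mat(lam+1|lam)` -/

/-- `M` is homogeneous of parity `p`. -/
def IsHomog {lam : ℕ} (p : ℕ) (M : Mat lam) : Prop :=
  ∀ a b : Fin (2 * lam + 1), M a b ≠ 0 → ((a : ℕ) + b) % 2 = p % 2

/-- The supertrace. -/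
noncomputable def str {lam : ℕ} (M : Mat lam) : ℂ := ∑ a : Fin (2 * lam + 1), (-1 : ℂ) ^ (a : ℕ) * M a a

/-- The diagonal rescaling of the basis; `b (2 lam + 1 - b) / 2` is the coefficient of `V`. -/
noncomputable def scale (lam a : ℕ) : ℂ :=
  ∏ b ∈ Finset.Icc 1 a, (-1 : ℂ) ^ b / ((b : ℂ) * (2 * lam + 1 - b) / 2)

/-- The supertransposition, taken in the rescaled basis in which it sends
`H, U, V` to `H, -V, U`. -/
noncomputable def st {lam : ℕ} (M : Mat lam) : Mat lam :=
  Matrix.of fun b a =>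
    (-1 : ℂ) ^ ((b : ℕ) * ((a : ℕ) + b)) * (scale lam b / scale lam a) * M a b

/-- The bilinear form `⟨v, w⟩ = str (v wᵗ)` on `B_lam`. -/
noncomputable def form {lam : ℕ} (v w : Mat lam) : ℂ := str (v * st w)

/-- `v` lies in the homogeneous component `(B_lam)_i` of the `ℤ`-grading by `ad H`. -/
def IsWeight (lam : ℕ) (i : ℤ) (v : Mat lam) : Prop :=
  bH lam * v - v * bH lam = (i : ℂ) • v

/-- `V ^ j` for `j ≥ 0`, and `U ^ (-j)` for `j < 0`. -/
noncomputable def pw (lam : ℕ) (j : ℤ) : Mat lam :=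
  if 0 ≤ j then bV lam ^ j.toNat else bU lam ^ (-j).toNat

/-- The form `⟨f, g⟩_j` on polynomials: `⟨f V^j, g V^j⟩` for `j ≥ 0` and
`⟨f U^{-j}, g U^{-j}⟩` for `j < 0`. -/
noncomputable def polyForm (lam : ℕ) (j : ℤ) (f g : ℂ[X]) : ℂ :=
  form (aeval (bH lam) f * pw lam j) (aeval (bH lam) g * pw lam j)

/-! ### The polynomials `f_{l, j}` -/

section Nested

variable {A : Type} [Ring A] [Algebra ℂ A]

/-- The defining relations of `U`, `V`, `H`, in an algebra in which all the differences
`H - (n + 1/2)`, with `n` an integer, are invertible. -/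
structure IsTriple (lam : ℕ) (U V H : A) : Prop where
  HU : H * U - U * H = -U
  HV : H * V - V * H = V
  VU : V * U = (1 / 2 : ℂ) • (algebraMap ℂ A (lam * (lam + 1)) - H ^ 2 + H)
  UV : U * V = (1 / 2 : ℂ) • (algebraMap ℂ A (lam * (lam + 1)) - H ^ 2 - H)
  unit : ∀ n : ℤ, IsUnit (H - algebraMap ℂ A (n + 1 / 2))

/-- The supercommutator `[v, w]` of elements of parities `p` and `q`. -/
noncomputable def sbr (p q : ℕ) (v w : A) : A := v * w - (-1 : A) ^ (p * q) * (w * v)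

/-- The bracket `{v, w} = v w - (-1)^{p (q + 1)} w v` of elements of parities `p` and `q`. -/
noncomputable def abr (p q : ℕ) (v w : A) : A := v * w - (-1 : A) ^ (p * (q + 1)) * (w * v)

/-- `H - (i + 1/2)`. -/
noncomputable def den (H : A) (i : ℕ) : A := H - algebraMap ℂ A (i + 1 / 2)

/-- `f_{2k, 2i} V^{2i}`: it is `V^{2i}` for `k = 0`, and for `k ≥ 1` it is
`[U, (H-(i+1/2))⁻¹ [U, [U, (H-(i+3/2))⁻¹ ⋯ (H-(i+k-3/2))⁻¹ [U, [U, V^{2i+2k-1}]] ⋯ ]]]`.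
The parity of `g(H) V^m` is the parity of `m`. -/
noncomputable def evenEven (U V H : A) : ℕ → ℕ → A
  | 0, i => V ^ (2 * i)
  | 1, i => sbr 1 1 U (V ^ (2 * i + 1))
  | k + 2, i => sbr 1 1 U (Ring.inverse (den H i) * sbr 1 0 U (evenEven U V H (k + 1) (i + 1)))

/-- `f_{2k+1, 2i} V^{2i}`, which is
`{U, (H-(i+1/2))⁻¹ {U, {U, (H-(i+3/2))⁻¹ ⋯ (H-(i+k-1/2))⁻¹ {U, {U, V^{2i+2k+1}}} ⋯ }}}`. -/
noncomputable def oddEven (U V H : A) : ℕ → ℕ → A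
  | 0, i => abr 1 1 U (V ^ (2 * i + 1))
  | k + 1, i => abr 1 1 U (Ring.inverse (den H i) * abr 1 0 U (oddEven U V H k (i + 1)))

/-- `f_{2k, 2i+1} V^{2i+1}`: it is `V^{2i+1}` for `k = 0`, and
`(H-(i+1/2))⁻¹ [U, f_{2k, 2i+2} V^{2i+2}]` for `k ≥ 1`. -/
noncomputable def evenOdd (U V H : A) : ℕ → ℕ → A
  | 0, i => V ^ (2 * i + 1)
  | k + 1, i => Ring.inverse (den H i) * sbr 1 0 U (evenEven U V H (k + 1) (i + 1))

/-- `f_{l, j} V^j`; for odd `l` and odd `j` it is `(H-(i+1/2)) f_{l-1, j} V^j`, `j = 2i+1`. -/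
noncomputable def nested (U V H : A) (l j : ℕ) : A :=
  if j % 2 = 0 then
    if l % 2 = 0 then evenEven U V H (l / 2) (j / 2) else oddEven U V H (l / 2) (j / 2)
  else
    if l % 2 = 0 then evenOdd U V H (l / 2) (j / 2)
    else den H (j / 2) * evenOdd U V H (l / 2) (j / 2)

end Nested

/-- `f` is the polynomial `f_{l, j}`: the identity `f(H) V^j = (nested bracket)` is a consequence
of the relations between `U`, `V`, `H` alone, so that it holds in `B_lam` in particular. -/
def IsF (lam l j : ℕ) (f : ℂ[X]) : Prop :=
  ∀ (A : Type) [Ring A] [Algebra ℂ A] (U V H : A), IsTriple lam U V H →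
    aeval H f * V ^ j = nested U V H l j

/-- `f(-H)`. -/
noncomputable def refl (f : ℂ[X]) : ℂ[X] := f.comp (-X)

/-- `Δ f = f(H + 1) - f(H)`. -/
noncomputable def fwd (f : ℂ[X]) : ℂ[X] := f.comp (X + 1) - f

/-- `∇ f = f(H) - f(H - 1)`. -/
noncomputable def bwd (f : ℂ[X]) : ℂ[X] := f - f.comp (X - 1)

/-- `p 0, p 1, ...` are orthogonal polynomials for `B`: `p l` has degree `l` and is orthogonal
to all polynomials of smaller degree. -/
def IsOrthogonalPolys (B : ℂ[X] → ℂ[X] → ℂ) (p : ℕ → ℂ[X]) : Prop :=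
  ∀ l : ℕ, (p l).degree = l ∧ ∀ g : ℂ[X], g.degree < l → B (p l) g = 0 ∧ B g (p l) = 0

/-- The Pochhammer symbol `(a)_n = a (a + 1) ⋯ (a + n - 1)`. -/
noncomputable def poch (a : ℂ) (n : ℕ) : ℂ := ∏ s ∈ Finset.range n, (a + s)

/-- The generalized hypergeometric series `₃F₂(a, b, c; d, e | x)`. -/
noncomputable def hyp3F2 (a b c d e x : ℂ) : ℂ :=
  ∑' n : ℕ, poch a n * poch b n * poch c n / (poch d n * poch e n) * (x ^ n / (n.factorial : ℂ))

end OspOneTwo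

open OspOneTwo

namespace OspOneTwo

/-! ### Leading coefficients of shifts -/

/-! Let `w` be the polynomial with `U V = w(H)`; then `V U = w(H - 1)`. Since `U` and `V` shift `H`
by one, the commutator or anticommutator of `U` with `g(H) V^m` is a polynomial in `H` times
`V^(m-1)`, namely `raise lam s m g` with `s = -1` or `s = 1`. The nested brackets thus become a
recursion on polynomials (`quo`, `brPoly`). The divisions by `H - (i + 1/2)` are exact because each
dividend is antisymmetric about `i + 1/2`, a symmetry that the recursion carries along.

The rest follows from properties of `raise`. It raises the degree by two for `s = 1` and by one for
`s = -1`, with a nonzero factor on the leading coefficient. It intertwines the difference operators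
of neighbouring indices, so the difference equations propagate from the constant `1`. For even index
and even degree the eigenvalue determines the degree, so an eigenfunction is fixed by its leading
coefficient; the dual Hahn sum is such an eigenfunction because the operator is bidiagonal in the
basis `(i - H)_n (H - i)_n`.

Up to sign, `⟨f, g⟩_j` is the alternating sum `altSum` of `f g` against the values of `V^j U^j` at
the eigenvalues of `H`. Abel summation makes `lower` the adjoint of `raise` (`altSum_raise_mul`).
Two such adjunctions with one division between them turn `(k + 1, i)` into `(k, i + 1)` and cost the
test polynomial two degrees. What remains is the sum of the constant `1`, evaluated recursively by
`altSum_one_succ` and nonzero exactly for `i ≤ lam`. Test polynomials of the opposite reflection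
symmetry pair to zero.

Uniqueness of `f_{l,j}` cannot be seen in `B_lam`, where `H` has finitely many eigenvalues; a triple
of operators on sequences over `ℤ` (`isTriple_seq`) separates polynomials. -/

theorem coeff_comp_X_add_C_of_natDegree_le {g : ℂ[X]} {n : ℕ} (hg : g.natDegree ≤ n + 1) (r : ℂ) :
    (g.comp (X + C r)).coeff n = g.coeff n + (n + 1) * r * g.coeff (n + 1) := by
  rw [← taylor_apply, taylor_coeff]
  have h1 : (hasseDeriv n g).natDegree ≤ 1 :=
    (natDegree_hasseDeriv_le g n).trans (by omega)
  rw [eq_X_add_C_of_natDegree_le_one h1]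
  simp only [hasseDeriv_coeff, eval_add, eval_mul, eval_C, eval_X]
  rw [add_comm 1 n, zero_add, Nat.choose_self, Nat.choose_succ_self_right]
  push_cast
  ring

theorem natDegree_comp_X_add_C (g : ℂ[X]) (r : ℂ) : (g.comp (X + C r)).natDegree = g.natDegree := by
  rw [← taylor_apply, natDegree_taylor]

theorem coeff_comp_X_add_C_of_natDegree_le' {g : ℂ[X]} {n : ℕ} (hg : g.natDegree ≤ n) (r : ℂ) :
    (g.comp (X + C r)).coeff n = g.coeff n := by
  rw [coeff_comp_X_add_C_of_natDegree_le (hg.trans n.le_succ),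
    coeff_eq_zero_of_natDegree_lt (Nat.lt_succ_of_le hg)]
  ring

theorem natDegree_comp_sub_self_le {g : ℂ[X]} {n : ℕ} (hg : g.natDegree ≤ n + 1) (r : ℂ) :
    (g.comp (X + C r) - g).natDegree ≤ n := by
  rw [natDegree_le_iff_coeff_eq_zero]
  intro N hN
  rw [coeff_sub, coeff_comp_X_add_C_of_natDegree_le' (by omega), sub_self]

theorem coeff_comp_sub_self {g : ℂ[X]} {n : ℕ} (hg : g.natDegree ≤ n + 1) (r : ℂ) :
    (g.comp (X + C r) - g).coeff n = (n + 1) * r * g.coeff (n + 1) := by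
  rw [coeff_sub, coeff_comp_X_add_C_of_natDegree_le hg, add_sub_cancel_left]

theorem natDegree_of_X_sub_C_mul_eq {q t : ℂ[X]} {a : ℂ} {n : ℕ} (h : (X - C a) * q = t)
    (ht : t.natDegree ≤ n + 1) : q.natDegree ≤ n := by
  by_cases hq : q = 0
  · simp [hq]
  · rw [← h, natDegree_mul (X_sub_C_ne_zero a) hq, natDegree_X_sub_C] at ht
    omega

theorem coeff_of_X_sub_C_mul_eq {q t : ℂ[X]} {a : ℂ} {n : ℕ} (h : (X - C a) * q = t)
    (ht : t.natDegree ≤ n + 1) : q.coeff n = t.coeff (n + 1) := by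
  have hq := natDegree_of_X_sub_C_mul_eq h ht
  rw [← h, sub_mul, coeff_sub, coeff_X_mul, coeff_C_mul,
    coeff_eq_zero_of_natDegree_lt (Nat.lt_succ_of_le hq)]
  ring

/-! ### The raising operators -/

/-- The polynomial `w` with `U V = w(H)`. -/
noncomputable def wPoly (lam : ℕ) : ℂ[X] := C (-1 / 2) * ((X - C (lam : ℂ)) * (X + C (lam + 1 : ℂ)))

theorem eval_wPoly (lam : ℕ) (x : ℂ) :
    (wPoly lam).eval x = -1 / 2 * ((x - lam) * (x + (lam + 1))) := by
  simp [wPoly]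

theorem natDegree_wPoly_le (lam : ℕ) : (wPoly lam).natDegree ≤ 2 := by
  rw [wPoly]
  compute_degree

theorem coeff_two_wPoly (lam : ℕ) : (wPoly lam).coeff 2 = -1 / 2 := by
  rw [wPoly, coeff_C_mul, show (2 : ℕ) = 1 + 1 from rfl, sub_mul, coeff_sub, coeff_X_mul,
    coeff_C_mul]
  simp [coeff_X, coeff_one]

/-- The operator `g ↦ g(H + 1) w(H) + s g(H) w(H - m)`; it describes `U g V^m ± g V^m U`. -/
noncomputable def raise (lam : ℕ) (s : ℂ) (m : ℕ) (g : ℂ[X]) : ℂ[X] :=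
  g.comp (X + C 1) * wPoly lam + C s * (g * (wPoly lam).comp (X + C (-(m : ℂ))))

theorem eval_raise (lam : ℕ) (s : ℂ) (m : ℕ) (g : ℂ[X]) (x : ℂ) :
    (raise lam s m g).eval x = g.eval (x + 1) * (wPoly lam).eval x
      + s * (g.eval x * (wPoly lam).eval (x - m)) := by
  simp [raise, sub_eq_add_neg]

theorem natDegree_raise_le (lam : ℕ) (s : ℂ) (m : ℕ) {g : ℂ[X]} {n : ℕ} (hg : g.natDegree ≤ n) :
    (raise lam s m g).natDegree ≤ n + 2 := by
  refine natDegree_add_le_of_degree_le ?_ ((natDegree_C_mul_le _ _).trans ?_) <;>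
  refine natDegree_mul_le_of_le ?_ ?_ <;>
  simp only [natDegree_comp_X_add_C, hg, natDegree_wPoly_le]

theorem coeff_raise_one (lam m : ℕ) {g : ℂ[X]} {n : ℕ} (hg : g.natDegree ≤ n) :
    (raise lam 1 m g).coeff (n + 2) = -g.coeff n := by
  have hw := natDegree_wPoly_le lam
  have hc := natDegree_comp_X_add_C
  rw [raise, map_one C, one_mul, coeff_add, ← map_one C,
    coeff_mul_add_eq_of_natDegree_le ((hc _ _).le.trans hg) hw,
    coeff_mul_add_eq_of_natDegree_le hg ((hc _ _).le.trans hw),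
    coeff_comp_X_add_C_of_natDegree_le' hg, coeff_comp_X_add_C_of_natDegree_le' hw,
    coeff_two_wPoly]
  ring

/-- `w(x) - w(x - m)` is linear in `x`, so for `s = -1` the top terms of the two summands cancel;
this form makes the cancellation visible. -/
theorem raise_neg_one (lam m : ℕ) (g : ℂ[X]) :
    raise lam (-1) m g = (g.comp (X + C 1) - g) * wPoly lam
      + g * (C (-(m : ℂ)) * X + C (-(m : ℂ) * (1 - m) / 2)) := by
  refine Polynomial.funext fun x => ?_
  simp only [eval_raise, eval_wPoly, eval_add, eval_mul, eval_sub, eval_comp, eval_X, eval_C]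
  ring

theorem natDegree_raise_neg_one_le (lam m : ℕ) {g : ℂ[X]} {n : ℕ} (hg : g.natDegree ≤ n) :
    (raise lam (-1) m g).natDegree ≤ n + 1 := by
  rw [raise_neg_one]
  refine natDegree_add_le_of_degree_le ?_ (natDegree_mul_le_of_le hg (by compute_degree))
  cases n with
  | zero =>
    rw [eq_C_of_natDegree_le_zero hg]
    simp
  | succ n =>
    exact (natDegree_mul_le_of_le (natDegree_comp_sub_self_le hg 1) (natDegree_wPoly_le lam)).trans
      (by omega)

theorem coeff_raise_neg_one (lam m : ℕ) {g : ℂ[X]} {n : ℕ} (hg : g.natDegree ≤ n) :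
    (raise lam (-1) m g).coeff (n + 1) = -1 / 2 * (n + 2 * m) * g.coeff n := by
  rw [raise_neg_one, coeff_add, coeff_mul_add_eq_of_natDegree_le hg (by compute_degree)]
  have h1 : (C (-(m : ℂ)) * X + C (-(m : ℂ) * (1 - m) / 2)).coeff 1 = -(m : ℂ) := by
    simp
  rw [h1]
  cases n with
  | zero =>
    rw [eq_C_of_natDegree_le_zero hg]
    simp
    ring
  | succ n =>
    rw [show n + 1 + 1 = n + 2 from rfl,
      coeff_mul_add_eq_of_natDegree_le (natDegree_comp_sub_self_le hg 1) (natDegree_wPoly_le lam),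
      coeff_comp_sub_self hg, coeff_two_wPoly]
    push_cast
    ring

/-! ### The polynomials `f_{l, j}` -/

/-- For `s = 1` the polynomial `f_{2k, 2i+1}`; for `s = -1` the corresponding intermediate quotient
in the definition of `f_{2k+1, 2i}`. -/
noncomputable def quo (lam : ℕ) (s : ℂ) : ℕ → ℕ → ℂ[X]
  | 0, _ => 1
  | k + 1, i =>
    raise lam (-s) (2 * i + 2) (raise lam s (2 * i + 3) (quo lam s k (i + 1)))
      /ₘ (X - C (i + 1 / 2 : ℂ))

/-- The polynomial `f_{2k+2, 2i}` for `s = 1` and `f_{2k+1, 2i}` for `s = -1`. -/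
noncomputable def brPoly (lam : ℕ) (s : ℂ) (k i : ℕ) : ℂ[X] := raise lam s (2 * i + 1) (quo lam s k i)

/-- The roots `lam` and `-lam - 1` of `w` are symmetric about `-1/2`. All reflection symmetries
below rest on this. -/
theorem eval_wPoly_neg (lam : ℕ) {x y : ℂ} (h : x + y = -1) :
    (wPoly lam).eval x = (wPoly lam).eval y := by
  obtain rfl : y = -1 - x := by linear_combination h
  rw [eval_wPoly, eval_wPoly]
  ring

theorem quo_succ_aux (lam : ℕ) (s : ℂ) (k i : ℕ) :
    quo lam s (k + 1) i = raise lam (-s) (2 * i + 2) (brPoly lam s k (i + 1))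
      /ₘ (X - C (i + 1 / 2 : ℂ)) := rfl

/-- The reflection `x ↦ 2i - x` exchanges the two summands of `raise`, and `s ^ 2 = 1` restores the
coefficients. The symmetry of `quo` is a hypothesis because both symmetries come out of a single
induction, completed in `eval_quo_reflect`. -/
theorem eval_brPoly_reflect_of {lam : ℕ} {s : ℂ} (hs : s ^ 2 = 1) {k i : ℕ}
    (h : ∀ x : ℂ, (quo lam s k i).eval (2 * i + 1 - x) = (quo lam s k i).eval x) (x : ℂ) :
    (brPoly lam s k i).eval (2 * i - x) = s * (brPoly lam s k i).eval x := by
  rw [brPoly, eval_raise, eval_raise, show (2 * i - x + 1 : ℂ) = 2 * i + 1 - x by ring, h,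
    show (2 * i - x : ℂ) = 2 * i + 1 - (x + 1) by ring, h,
    eval_wPoly_neg lam (x := 2 * i + 1 - (x + 1)) (y := x - (2 * i + 1 : ℕ)) (by push_cast; ring),
    eval_wPoly_neg lam (x := 2 * i + 1 - (x + 1) - (2 * i + 1 : ℕ)) (y := x) (by push_cast; ring)]
  linear_combination -(quo lam s k i).eval x * (wPoly lam).eval (x - (2 * i + 1 : ℕ)) * hs

theorem eval_raise_reflect {lam : ℕ} {s : ℂ} (hs : s ^ 2 = 1) {i : ℕ} {g : ℂ[X]}
    (h : ∀ x : ℂ, g.eval (2 * (i + 1 : ℕ) - x) = s * g.eval x) (x : ℂ) :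
    (raise lam (-s) (2 * i + 2) g).eval (2 * i + 1 - x)
      = -(raise lam (-s) (2 * i + 2) g).eval x := by
  rw [eval_raise, eval_raise,
    show (2 * i + 1 - x + 1 : ℂ) = 2 * (i + 1 : ℕ) - x by push_cast; ring, h,
    show (2 * i + 1 - x : ℂ) = 2 * (i + 1 : ℕ) - (x + 1) by push_cast; ring, h,
    eval_wPoly_neg lam (x := 2 * (i + 1 : ℕ) - (x + 1)) (y := x - (2 * i + 2 : ℕ))
      (by push_cast; ring),
    eval_wPoly_neg lam (x := 2 * (i + 1 : ℕ) - (x + 1) - (2 * i + 2 : ℕ)) (y := x)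
      (by push_cast; ring)]
  linear_combination -g.eval (x + 1) * (wPoly lam).eval x * hs

/-- The point `i + 1/2` is fixed by the reflection, so an antisymmetric polynomial vanishes there
and the division has no remainder. -/
theorem X_sub_C_mul_divByMonic_of_reflect {t : ℂ[X]} {i : ℕ}
    (h : ∀ x : ℂ, t.eval (2 * i + 1 - x) = -t.eval x) :
    (X - C (i + 1 / 2 : ℂ)) * (t /ₘ (X - C (i + 1 / 2 : ℂ))) = t := by
  rw [mul_divByMonic_eq_iff_isRoot, IsRoot]
  have := h (i + 1 / 2)
  rw [show (2 * i + 1 - (i + 1 / 2) : ℂ) = i + 1 / 2 by ring] at this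
  linear_combination 1 / 2 * this

theorem eval_reflect_of_mul {t r : ℂ[X]} {i : ℕ} {e : ℂ}
    (ht : ∀ x : ℂ, t.eval (2 * i + 1 - x) = e * t.eval x) (h : (X - C (i + 1 / 2 : ℂ)) * r = t)
    (x : ℂ) : r.eval (2 * i + 1 - x) = -e * r.eval x := by
  have hp : (X - C (i + 1 / 2 : ℂ)) * r.comp (C (2 * i + 1 : ℂ) - X)
      = (X - C (i + 1 / 2 : ℂ)) * (C (-e) * r) := by
    refine Polynomial.funext fun y => ?_
    have := ht y
    rw [← h] at this
    simp only [eval_mul, eval_sub, eval_X, eval_C, eval_comp] at this ⊢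
    linear_combination -this
  have := congrArg (eval x) (mul_left_cancel₀ (X_sub_C_ne_zero _) hp)
  simpa using this

theorem eval_quo_reflect {lam : ℕ} {s : ℂ} (hs : s ^ 2 = 1) (k i : ℕ) (x : ℂ) :
    (quo lam s k i).eval (2 * i + 1 - x) = (quo lam s k i).eval x := by
  induction k generalizing i x with
  | zero => simp [quo]
  | succ k ih =>
    have h1 := eval_raise_reflect (lam := lam) hs
      (eval_brPoly_reflect_of hs (i := i + 1) (k := k) (ih (i + 1)))
    have h2 := eval_reflect_of_mul (e := -1) (fun x => (h1 x).trans (neg_one_mul _).symm)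
      (X_sub_C_mul_divByMonic_of_reflect h1) x
    rw [quo_succ_aux, h2, neg_neg, one_mul]

theorem eval_brPoly_reflect {lam : ℕ} {s : ℂ} (hs : s ^ 2 = 1) (k i : ℕ) (x : ℂ) :
    (brPoly lam s k i).eval (2 * i - x) = s * (brPoly lam s k i).eval x :=
  eval_brPoly_reflect_of hs (eval_quo_reflect hs k i) x

theorem X_sub_C_mul_quo_succ {lam : ℕ} {s : ℂ} (hs : s ^ 2 = 1) (k i : ℕ) :
    (X - C (i + 1 / 2 : ℂ)) * quo lam s (k + 1) i
      = raise lam (-s) (2 * i + 2) (brPoly lam s k (i + 1)) :=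
  X_sub_C_mul_divByMonic_of_reflect (eval_raise_reflect hs (eval_brPoly_reflect hs k (i + 1)))

theorem natDegree_brPoly_one_le_of {lam k i : ℕ} (h : (quo lam 1 k i).natDegree ≤ 2 * k) :
    (brPoly lam 1 k i).natDegree ≤ 2 * k + 2 := natDegree_raise_le lam 1 _ h

theorem natDegree_brPoly_neg_one_le_of {lam k i : ℕ} (h : (quo lam (-1) k i).natDegree ≤ 2 * k) :
    (brPoly lam (-1) k i).natDegree ≤ 2 * k + 1 := natDegree_raise_neg_one_le lam _ h

theorem natDegree_quo_one_le (lam k i : ℕ) : (quo lam 1 k i).natDegree ≤ 2 * k := by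
  induction k generalizing i with
  | zero => simp [quo]
  | succ k ih =>
    refine natDegree_of_X_sub_C_mul_eq (X_sub_C_mul_quo_succ (by norm_num) k i) ?_
    exact natDegree_raise_neg_one_le lam _ (natDegree_brPoly_one_le_of (ih (i + 1)))

theorem natDegree_quo_neg_one_le (lam k i : ℕ) : (quo lam (-1) k i).natDegree ≤ 2 * k := by
  induction k generalizing i with
  | zero => simp [quo]
  | succ k ih =>
    refine natDegree_of_X_sub_C_mul_eq (X_sub_C_mul_quo_succ (by norm_num) k i) ?_
    exact natDegree_raise_le lam _ _ (natDegree_brPoly_neg_one_le_of (ih (i + 1)))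

theorem natDegree_brPoly_one_le (lam k i : ℕ) : (brPoly lam 1 k i).natDegree ≤ 2 * k + 2 :=
  natDegree_brPoly_one_le_of (natDegree_quo_one_le lam k i)

theorem natDegree_brPoly_neg_one_le (lam k i : ℕ) : (brPoly lam (-1) k i).natDegree ≤ 2 * k + 1 :=
  natDegree_brPoly_neg_one_le_of (natDegree_quo_neg_one_le lam k i)

theorem coeff_brPoly_one (lam k i : ℕ) :
    (brPoly lam 1 k i).coeff (2 * k + 2) = -(quo lam 1 k i).coeff (2 * k) :=
  coeff_raise_one lam _ (natDegree_quo_one_le lam k i)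

theorem coeff_brPoly_neg_one (lam k i : ℕ) :
    (brPoly lam (-1) k i).coeff (2 * k + 1)
      = -1 / 2 * ((2 * k : ℕ) + 2 * (2 * i + 1 : ℕ)) * (quo lam (-1) k i).coeff (2 * k) :=
  coeff_raise_neg_one lam _ (natDegree_quo_neg_one_le lam k i)

theorem coeff_quo_one_succ (lam k i : ℕ) :
    (quo lam 1 (k + 1) i).coeff (2 * k + 2)
      = (k + 2 * i + 3) * (quo lam 1 k (i + 1)).coeff (2 * k) := by
  have hd := natDegree_brPoly_one_le lam k (i + 1)
  rw [coeff_of_X_sub_C_mul_eq (X_sub_C_mul_quo_succ (by norm_num) k i)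
    (natDegree_raise_neg_one_le lam _ hd), coeff_raise_neg_one lam _ hd, coeff_brPoly_one]
  push_cast
  ring

theorem coeff_quo_neg_one_succ (lam k i : ℕ) :
    (quo lam (-1) (k + 1) i).coeff (2 * k + 2)
      = (k + 2 * i + 3) * (quo lam (-1) k (i + 1)).coeff (2 * k) := by
  have hd := natDegree_brPoly_neg_one_le lam k (i + 1)
  have h := X_sub_C_mul_quo_succ (lam := lam) (s := -1) (by norm_num) k i
  rw [neg_neg] at h
  rw [coeff_of_X_sub_C_mul_eq h (natDegree_raise_le lam _ _ hd), coeff_raise_one lam _ hd,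
    coeff_brPoly_neg_one]
  push_cast
  ring

theorem coeff_quo_one (lam k i : ℕ) :
    (quo lam 1 k i).coeff (2 * k) = poch (2 * i + k + 2) k := by
  induction k generalizing i with
  | zero => simp [quo, poch]
  | succ k ih =>
    rw [show 2 * (k + 1) = 2 * k + 2 from rfl, coeff_quo_one_succ, ih, poch, poch,
      Finset.prod_range_succ']
    push_cast
    rw [mul_comm]
    congr 1
    · refine Finset.prod_congr rfl fun n _ => ?_
      ring
    · ring

theorem coeff_quo_neg_one_ne_zero (lam k i : ℕ) : (quo lam (-1) k i).coeff (2 * k) ≠ 0 := by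
  induction k generalizing i with
  | zero => simp [quo]
  | succ k ih =>
    rw [show 2 * (k + 1) = 2 * k + 2 from rfl, coeff_quo_neg_one_succ]
    exact mul_ne_zero (by exact_mod_cast (by omega : k + 2 * i + 3 ≠ 0)) (ih (i + 1))

theorem coeff_quo_one_ne_zero (lam k i : ℕ) : (quo lam 1 k i).coeff (2 * k) ≠ 0 := by
  rw [coeff_quo_one, poch, Finset.prod_ne_zero_iff]
  intro n _
  exact_mod_cast (by omega : 2 * i + k + 2 + n ≠ 0)

theorem coeff_brPoly_neg_one_ne_zero (lam k i : ℕ) : (brPoly lam (-1) k i).coeff (2 * k + 1) ≠ 0 := by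
  rw [coeff_brPoly_neg_one]
  refine mul_ne_zero (mul_ne_zero (by norm_num) ?_) (coeff_quo_neg_one_ne_zero lam k i)
  exact_mod_cast (by omega : 2 * k + 2 * (2 * i + 1) ≠ 0)

theorem coeff_brPoly_one_ne_zero (lam k i : ℕ) : (brPoly lam 1 k i).coeff (2 * k + 2) ≠ 0 := by
  rw [coeff_brPoly_one, neg_ne_zero]
  exact coeff_quo_one_ne_zero lam k i

/-! ### Difference equations -/

/-- The difference equation of index `2i`, with denominators cleared. -/
def EvenEigen (lam i : ℕ) (c e : ℂ) (f : ℂ[X]) : Prop :=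
  ∀ x : ℂ, -((wPoly lam).eval x * (f.eval (x + 1) - f.eval x) * (x - i - 1 / 2)
      + (wPoly lam).eval (x - 2 * i - 1) * (f.eval x - f.eval (x - 1)) * (x - i + 1 / 2))
      + c * f.eval x = e * f.eval x * ((x - i) ^ 2 - 1 / 4)

/-- The difference equation of index `2i + 1`, with denominators cleared. -/
def OddEigen (lam i : ℕ) (e : ℂ) (h : ℂ[X]) : Prop :=
  ∀ x : ℂ, -((wPoly lam).eval x * (h.eval (x + 1) - h.eval x)
      + (wPoly lam).eval (x - 2 * i - 2) * (h.eval x - h.eval (x - 1)))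
      = e * (x - i - 1 / 2) * h.eval x

/-- The equations for `h` at `x + 1` and `x` are combined with the weights `w(x)` and `w(x - 2i -
1)` that `raise` itself uses; the extra linear factors clear the denominators of the even equation.
-/
theorem OddEigen.raise_one {lam i : ℕ} {e : ℂ} {h : ℂ[X]} (H : OddEigen lam i e h) :
    EvenEigen lam i 0 (e + 2) (raise lam 1 (2 * i + 1) h) := by
  intro x
  have h1 := H (x + 1)
  have h0 := H x
  simp only [eval_raise]
  simp only [add_sub_cancel_right, sub_add_cancel, eval_wPoly] at h0 h1 ⊢
  push_cast
  linear_combination (-1 / 2 * ((x - lam) * (x + (lam + 1)))) * (x - i - 1 / 2) * h1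
    + (-1 / 2 * ((x - 2 * i - 1 - lam) * (x - 2 * i - 1 + (lam + 1)))) * (x - i + 1 / 2) * h0

theorem OddEigen.raise_neg_one {lam i : ℕ} {e : ℂ} {h : ℂ[X]} (H : OddEigen lam i e h) :
    EvenEigen lam i ((lam + 1 / 2) ^ 2 - (i : ℂ) ^ 2) (e + 1) (raise lam (-1) (2 * i + 1) h) := by
  intro x
  have h1 := H (x + 1)
  have h0 := H x
  simp only [eval_raise]
  simp only [add_sub_cancel_right, sub_add_cancel, eval_wPoly] at h0 h1 ⊢
  push_cast
  linear_combination (-1 / 2 * ((x - lam) * (x + (lam + 1)))) * (x - i - 1 / 2) * h1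
    - (-1 / 2 * ((x - 2 * i - 1 - lam) * (x - 2 * i - 1 + (lam + 1)))) * (x - i + 1 / 2) * h0

/-- The three linear factors are `y - (i + 1/2)` at `y = x - 1, x, x + 1`. They may be cancelled as
polynomials, although not at each single point. -/
theorem OddEigen.of_forall_mul {lam i : ℕ} {e : ℂ} {h : ℂ[X]}
    (H : ∀ x : ℂ, (x - i - 1 / 2 - 1) * (x - i - 1 / 2) * (x - i - 1 / 2 + 1) *
      -((wPoly lam).eval x * (h.eval (x + 1) - h.eval x)
        + (wPoly lam).eval (x - 2 * i - 2) * (h.eval x - h.eval (x - 1)))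
      = (x - i - 1 / 2 - 1) * (x - i - 1 / 2) * (x - i - 1 / 2 + 1) *
        (e * (x - i - 1 / 2) * h.eval x)) : OddEigen lam i e h := by
  have key : (X - C (i + 3 / 2 : ℂ)) * (X - C (i + 1 / 2 : ℂ)) * (X - C (i - 1 / 2 : ℂ)) *
      -(wPoly lam * (h.comp (X + C 1) - h)
        + (wPoly lam).comp (X - C (2 * i + 2 : ℂ)) * (h - h.comp (X - C 1)))
      = (X - C (i + 3 / 2 : ℂ)) * (X - C (i + 1 / 2 : ℂ)) * (X - C (i - 1 / 2 : ℂ)) *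
        (C e * (X - C (i + 1 / 2 : ℂ)) * h) := by
    refine Polynomial.funext fun x => ?_
    have := H x
    simp only [eval_mul, eval_neg, eval_add, eval_sub, eval_comp, eval_X, eval_C, sub_sub] at this ⊢
    norm_num only at this ⊢
    linear_combination this
  have key' := mul_left_cancel₀ (mul_ne_zero (mul_ne_zero (X_sub_C_ne_zero _) (X_sub_C_ne_zero _))
    (X_sub_C_ne_zero _)) key
  intro x
  have := congrArg (eval x) key'
  simp only [eval_mul, eval_neg, eval_add, eval_sub, eval_comp, eval_X, eval_C] at this
  rw [sub_sub x, sub_sub x]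
  exact this

/-- `h` is known only through its product with `X - (i + 1/2)`, and its values at `x - 1, x, x + 1`
occur. Multiplying by the three linear factors lets `dm`, `d0`, `d1` eliminate them, after which the
even equations for `g` at `x` and `x + 1` suffice. -/
theorem EvenEigen.of_raise_neg_one {lam i : ℕ} {e : ℂ} {g h : ℂ[X]}
    (H : EvenEigen lam (i + 1) 0 e g)
    (hh : (X - C (i + 1 / 2 : ℂ)) * h = raise lam (-1) (2 * i + 2) g) :
    OddEigen lam i e h := by
  refine OddEigen.of_forall_mul fun x => ?_
  have h1 := H (x + 1)
  have h0 := H x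
  have d1 := congrArg (eval (x + 1)) hh
  have d0 := congrArg (eval x) hh
  have dm := congrArg (eval (x - 1)) hh
  simp only [eval_raise, eval_mul, eval_sub, eval_X, eval_C] at d1 d0 dm
  simp only [add_sub_cancel_right, sub_add_cancel, eval_wPoly] at h0 h1 d1 d0 dm ⊢
  push_cast at *
  linear_combination (-1 / 2 * ((x - lam) * (x + (lam + 1)))) * (x - i - 1 / 2 - 1) * h1
    - (-1 / 2 * ((x - 2 * i - 2 - lam) * (x - 2 * i - 2 + (lam + 1)))) * (x - i - 1 / 2 + 1) * h0
    - (-1 / 2 * ((x - lam) * (x + (lam + 1)))) * (x - i - 1 / 2) * (x - i - 1 / 2 - 1) * d1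
    + ((-1 / 2 * ((x - lam) * (x + (lam + 1))))
        - (-1 / 2 * ((x - 2 * i - 2 - lam) * (x - 2 * i - 2 + (lam + 1)))) - e * (x - i - 1 / 2))
      * (x - i - 1 / 2 - 1) * (x - i - 1 / 2 + 1) * d0
    + (-1 / 2 * ((x - 2 * i - 2 - lam) * (x - 2 * i - 2 + (lam + 1)))) * (x - i - 1 / 2)
      * (x - i - 1 / 2 + 1) * dm

theorem EvenEigen.of_raise_one {lam i : ℕ} {e : ℂ} {g h : ℂ[X]}
    (H : EvenEigen lam (i + 1) ((lam + 1 / 2) ^ 2 - ((i + 1 : ℕ) : ℂ) ^ 2) e g)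
    (hh : (X - C (i + 1 / 2 : ℂ)) * h = raise lam 1 (2 * i + 2) g) :
    OddEigen lam i (e + 1) h := by
  refine OddEigen.of_forall_mul fun x => ?_
  have h1 := H (x + 1)
  have h0 := H x
  have d1 := congrArg (eval (x + 1)) hh
  have d0 := congrArg (eval x) hh
  have dm := congrArg (eval (x - 1)) hh
  simp only [eval_raise, eval_mul, eval_sub, eval_X, eval_C] at d1 d0 dm
  simp only [add_sub_cancel_right, sub_add_cancel, eval_wPoly] at h0 h1 d1 d0 dm ⊢
  push_cast at *
  linear_combination (-1 / 2 * ((x - lam) * (x + (lam + 1)))) * (x - i - 1 / 2 - 1) * h1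
    + (-1 / 2 * ((x - 2 * i - 2 - lam) * (x - 2 * i - 2 + (lam + 1)))) * (x - i - 1 / 2 + 1) * h0
    - (-1 / 2 * ((x - lam) * (x + (lam + 1)))) * (x - i - 1 / 2) * (x - i - 1 / 2 - 1) * d1
    + ((-1 / 2 * ((x - lam) * (x + (lam + 1))))
        - (-1 / 2 * ((x - 2 * i - 2 - lam) * (x - 2 * i - 2 + (lam + 1))))
        - (e + 1) * (x - i - 1 / 2))
      * (x - i - 1 / 2 - 1) * (x - i - 1 / 2 + 1) * d0
    + (-1 / 2 * ((x - 2 * i - 2 - lam) * (x - 2 * i - 2 + (lam + 1)))) * (x - i - 1 / 2)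
      * (x - i - 1 / 2 + 1) * dm

theorem oddEigen_quo_one (lam k i : ℕ) : OddEigen lam i (2 * k) (quo lam 1 k i) := by
  induction k generalizing i with
  | zero => intro x; simp [quo]
  | succ k ih =>
    have := (ih (i + 1)).raise_one.of_raise_neg_one (X_sub_C_mul_quo_succ (by norm_num) k i)
    convert this using 1
    push_cast
    ring

theorem oddEigen_quo_neg_one (lam k i : ℕ) : OddEigen lam i (2 * k) (quo lam (-1) k i) := by
  induction k generalizing i with
  | zero => intro x; simp [quo]
  | succ k ih =>
    have h := X_sub_C_mul_quo_succ (lam := lam) (s := -1) (by norm_num) k i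
    rw [neg_neg] at h
    have := (ih (i + 1)).raise_neg_one.of_raise_one h
    convert this using 1
    push_cast
    ring

theorem evenEigen_brPoly_one (lam k i : ℕ) : EvenEigen lam i 0 (2 * k + 2) (brPoly lam 1 k i) :=
  (oddEigen_quo_one lam k i).raise_one

theorem evenEigen_brPoly_neg_one (lam k i : ℕ) :
    EvenEigen lam i ((lam + 1 / 2) ^ 2 - (i : ℂ) ^ 2) (2 * k + 1) (brPoly lam (-1) k i) :=
  (oddEigen_quo_neg_one lam k i).raise_neg_one

theorem eval_fwd (f : ℂ[X]) (z : ℂ) : (fwd f).eval z = f.eval (z + 1) - f.eval z := by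
  simp [fwd]

theorem eval_bwd (f : ℂ[X]) (z : ℂ) : (bwd f).eval z = f.eval z - f.eval (z - 1) := by
  simp [bwd]

theorem EvenEigen.difference_equation {lam i : ℕ} {c e : ℂ} {f : ℂ[X]}
    (H : EvenEigen lam i c e f) {z : ℂ} (h1 : 2 * z - 2 * i + 1 ≠ 0) (h2 : 2 * z - 2 * i - 1 ≠ 0) :
    (z - lam) * (z + lam + 1) / (2 * z - 2 * i + 1) * (fwd f).eval z
      + (z - 2 * i - lam - 1) * (z - 2 * i + lam) / (2 * z - 2 * i - 1) * (bwd f).eval z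
      + c / ((z - i) ^ 2 - 1 / 4) * f.eval z = e * f.eval z := by
  have hz := H z
  rw [eval_wPoly, eval_wPoly] at hz
  have h3 : (z - i) ^ 2 - 1 / 4 = (2 * z - 2 * i + 1) * (2 * z - 2 * i - 1) / 4 := by ring
  rw [eval_fwd, eval_bwd, h3]
  generalize hA : 2 * z - 2 * i + 1 = A at h1 ⊢
  generalize hB : 2 * z - 2 * i - 1 = B at h2 ⊢
  field_simp
  rw [← hA, ← hB]
  linear_combination 4 * hz

theorem OddEigen.difference_equation {lam i : ℕ} {e : ℂ} {f : ℂ[X]}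
    (H : OddEigen lam i e f) {z : ℂ} (h1 : 2 * z - 2 * i - 1 ≠ 0) :
    (z - lam) * (z + lam + 1) / (2 * z - 2 * i - 1) * (fwd f).eval z
      + (z - 2 * i - 1 + lam) * (z - 2 * i - 2 - lam) / (2 * z - 2 * i - 1) * (bwd f).eval z
      = e * f.eval z := by
  have hz := H z
  rw [eval_wPoly, eval_wPoly] at hz
  rw [eval_fwd, eval_bwd]
  generalize hA : 2 * z - 2 * i - 1 = A at h1 ⊢
  field_simp
  rw [← hA]
  linear_combination 2 * hz

/-! ### The dual Hahn polynomials -/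

theorem poch_zero (a : ℂ) : poch a 0 = 1 := by simp [poch]

theorem poch_succ (a : ℂ) (n : ℕ) : poch a (n + 1) = poch a n * (a + n) := by
  rw [poch, Finset.prod_range_succ, ← poch]

theorem poch_succ' (a : ℂ) (n : ℕ) : poch a (n + 1) = a * poch (a + 1) n := by
  rw [poch, Finset.prod_range_succ', poch, mul_comm]
  congr 1
  · simp
  · refine Finset.prod_congr rfl fun s _ => ?_
    push_cast
    ring

theorem poch_add (a : ℂ) (m n : ℕ) : poch a (m + n) = poch a m * poch (a + m) n := by
  rw [poch, Finset.prod_range_add, ← poch, poch]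
  congr 1
  refine Finset.prod_congr rfl fun s _ => ?_
  push_cast
  ring

theorem poch_neg_eq_zero {k n : ℕ} (h : k < n) : poch (-(k : ℂ)) n = 0 := by
  rw [poch, Finset.prod_eq_zero_iff]
  exact ⟨k, Finset.mem_range.2 h, by ring⟩

theorem poch_neg_self (k : ℕ) : poch (-(k : ℂ)) k = (-1) ^ k * (k.factorial : ℂ) := by
  induction k with
  | zero => simp [poch]
  | succ k ih =>
    rw [poch_succ', show -((k + 1 : ℕ) : ℂ) + 1 = -(k : ℂ) by push_cast; ring, ih,
      Nat.factorial_succ]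
    push_cast
    ring

/-- The basis `(i - H)_n (H - i)_n` of the polynomials symmetric about `i`. -/
noncomputable def symBasis (i n : ℕ) : ℂ[X] :=
  ∏ s ∈ Finset.range n, ((C (i + s : ℂ) - X) * (X - C (i - s : ℂ)))

theorem eval_symBasis (i n : ℕ) (z : ℂ) :
    (symBasis i n).eval z = poch (i - z) n * poch (z - i) n := by
  rw [symBasis, eval_prod, poch, poch, ← Finset.prod_mul_distrib]
  refine Finset.prod_congr rfl fun s _ => ?_
  simp only [eval_mul, eval_sub, eval_C, eval_X]
  ring

theorem symBasis_succ (i n : ℕ) :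
    symBasis i (n + 1) = symBasis i n * ((C (i + n : ℂ) - X) * (X - C (i - n : ℂ))) := by
  rw [symBasis, Finset.prod_range_succ, ← symBasis]

theorem natDegree_symBasis_le (i n : ℕ) : (symBasis i n).natDegree ≤ 2 * n := by
  induction n with
  | zero => simp [symBasis]
  | succ n ih =>
    rw [symBasis_succ]
    exact natDegree_mul_le_of_le ih (by compute_degree)

theorem coeff_symBasis (i n : ℕ) : (symBasis i n).coeff (2 * n) = (-1) ^ n := by
  induction n with
  | zero => simp [symBasis]
  | succ n ih =>
    have h1 : (C (i + n : ℂ) - X).natDegree ≤ 1 := by compute_degree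
    have h2 : (X - C (i - n : ℂ)).natDegree ≤ 1 := by compute_degree
    rw [symBasis_succ, show 2 * (n + 1) = 2 * n + (1 + 1) from rfl,
      coeff_mul_add_eq_of_natDegree_le (natDegree_symBasis_le i n) (natDegree_mul_le_of_le h1 h2),
      coeff_mul_add_eq_of_natDegree_le h1 h2, ih]
    simp [coeff_X, pow_succ]

/-- The difference operator is bidiagonal in the symmetric basis, which reduces the eigenvalue
equation to a two-term recurrence for the coefficients. -/
theorem evenOperator_symBasis (lam i n : ℕ) (x : ℂ) :
    -((wPoly lam).eval x * ((symBasis i (n + 1)).eval (x + 1) - (symBasis i (n + 1)).eval x)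
        * (x - i - 1 / 2)
      + (wPoly lam).eval (x - 2 * i - 1)
        * ((symBasis i (n + 1)).eval x - (symBasis i (n + 1)).eval (x - 1)) * (x - i + 1 / 2))
      = 2 * (n + 1) * ((symBasis i (n + 1)).eval x
        - (n + i - lam) * (n + 1 + i + lam) * (symBasis i n).eval x) * ((x - i) ^ 2 - 1 / 4) := by
  obtain ⟨y, rfl⟩ : ∃ y, x = y + i := ⟨x - i, by ring⟩
  simp only [eval_symBasis, eval_wPoly]
  rw [show (i : ℂ) - (y + i + 1) = -y - 1 by ring, show y + i + 1 - (i : ℂ) = y + 1 by ring,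
    show (i : ℂ) - (y + i) = -y by ring, show y + i - (i : ℂ) = y by ring,
    show (i : ℂ) - (y + i - 1) = -y + 1 by ring, show y + i - 1 - (i : ℂ) = y - 1 by ring]
  rw [poch_succ' (-y - 1), poch_succ' (y - 1), poch_succ (y + 1), poch_succ (-y + 1),
    sub_add_cancel, sub_add_cancel, poch_succ y, poch_succ (-y)]
  cases n with
  | zero => simp only [poch_zero]; push_cast; ring
  | succ n =>
    -- After this rewriting every term is a multiple of `poch (y + 1) n * poch (-y + 1) n`.
    rw [poch_succ' y, poch_succ' (-y), poch_succ (y + 1), poch_succ (-y + 1)]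
    push_cast
    ring

/-! ### Eigenfunctions are determined by their leading coefficient -/

/-- The forward and the backward difference each multiply the leading coefficient by the degree, `w`
contributes `-1/2` in both terms, and comparison two degrees above `d` gives the eigenvalue. -/
theorem EvenEigen.eq_natDegree {lam i : ℕ} {e : ℂ} {d : ℂ[X]} (H : EvenEigen lam i 0 e d)
    (hd : d ≠ 0) : e = d.natDegree := by
  have key : (wPoly lam * (d.comp (X + C 1) - d)) * (X - C (i + 1 / 2 : ℂ))
      - ((wPoly lam).comp (X + C (-(2 * i + 1) : ℂ)) * (d.comp (X + C (-1)) - d))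
        * (X - C (i - 1 / 2 : ℂ))
      = C (-e) * (d * ((X - C (i + 1 / 2 : ℂ)) * (X - C (i - 1 / 2 : ℂ)))) := by
    refine Polynomial.funext fun x => ?_
    have := H x
    simp only [eval_mul, eval_sub, eval_comp, eval_X, eval_C, eval_add]
    rw [show x + -1 = x - 1 by ring, show x + -(2 * i + 1 : ℂ) = x - 2 * i - 1 by ring]
    linear_combination -this
  have hl1 : (X - C (i + 1 / 2 : ℂ)).natDegree ≤ 1 := natDegree_X_sub_C_le _
  have hl2 : (X - C (i - 1 / 2 : ℂ)).natDegree ≤ 1 := natDegree_X_sub_C_le _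
  have hc : ∀ a : ℂ, (X - C a).coeff 1 = 1 := fun a => by simp
  have hcoeff := congrArg (fun p => p.coeff (d.natDegree + (1 + 1))) key
  simp only [coeff_C_mul] at hcoeff
  rw [coeff_mul_add_eq_of_natDegree_le le_rfl (natDegree_mul_le_of_le hl1 hl2),
    coeff_mul_add_eq_of_natDegree_le hl1 hl2, hc, hc, coeff_natDegree] at hcoeff
  have hlead : d.leadingCoeff ≠ 0 := leadingCoeff_ne_zero.2 hd
  refine mul_right_cancel₀ hlead ?_
  -- For a constant `d` both differences vanish; the coefficient formula for differences needs
  -- positive degree.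
  rcases hn : d.natDegree with _ | n
  · rw [eq_C_of_natDegree_le_zero hn.le] at hcoeff ⊢
    simp at hcoeff ⊢
    exact hcoeff
  · have hw := natDegree_wPoly_le lam
    have hw' := (natDegree_comp_X_add_C (wPoly lam) (-(2 * i + 1) : ℂ)).le.trans hw
    have hf := natDegree_comp_sub_self_le hn.le 1
    have hb := natDegree_comp_sub_self_le hn.le (-1)
    rw [hn, show n + 1 + (1 + 1) = 2 + n + 1 by ring, coeff_sub,
      coeff_mul_add_eq_of_natDegree_le (natDegree_mul_le_of_le hw hf) hl1,
      coeff_mul_add_eq_of_natDegree_le (natDegree_mul_le_of_le hw' hb) hl2, hc, hc,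
      coeff_mul_add_eq_of_natDegree_le hw hf, coeff_mul_add_eq_of_natDegree_le hw' hb,
      coeff_comp_sub_self hn.le, coeff_comp_sub_self hn.le,
      coeff_comp_X_add_C_of_natDegree_le' hw, coeff_two_wPoly, ← hn, coeff_natDegree] at hcoeff
    push_cast
    linear_combination hcoeff

theorem EvenEigen.sub {lam i : ℕ} {c e : ℂ} {f g : ℂ[X]} (hf : EvenEigen lam i c e f)
    (hg : EvenEigen lam i c e g) : EvenEigen lam i c e (f - g) := by
  intro x
  simp only [eval_sub]
  linear_combination hf x - hg x

theorem EvenEigen.C_mul {lam i : ℕ} {c e : ℂ} {f : ℂ[X]} (hf : EvenEigen lam i c e f) (a : ℂ) :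
    EvenEigen lam i c e (C a * f) := by
  intro x
  simp only [eval_mul, eval_C]
  linear_combination a * hf x

theorem EvenEigen.ext {lam i n : ℕ} {f g : ℂ[X]} (hf : EvenEigen lam i 0 n f)
    (hg : EvenEigen lam i 0 n g) (h : f.coeff n = g.coeff n) : f = g := by
  by_contra hne
  have hd := sub_ne_zero.2 hne
  have hn : n = (f - g).natDegree := by exact_mod_cast (hf.sub hg).eq_natDegree hd
  refine leadingCoeff_ne_zero.2 hd ?_
  rw [leadingCoeff, ← hn, coeff_sub, h, sub_self]

/-- The coefficients of the dual Hahn polynomials in the symmetric basis. -/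
noncomputable def hahnCoeff (lam k i n : ℕ) : ℂ :=
  poch (-k) n / (n.factorial : ℂ) * poch (lam + i + 1 + n) (k - n) * poch (i - lam + n) (k - n)

/-- The dual Hahn polynomials with cleared lower parameters. -/
noncomputable def hahn (lam k i : ℕ) : ℂ[X] :=
  ∑ n ∈ Finset.range (k + 1), C (hahnCoeff lam k i n) * symBasis i n

/-- Because the lower parameters are cleared, the recurrence also holds when `(i - lam)_n` vanishes,
so no bound on `k + i` is needed. -/
theorem hahnCoeff_succ (lam i : ℕ) {k n : ℕ} (h : n < k) :
    hahnCoeff lam k i (n + 1) * (n + 1) * ((n + i - lam) * (n + 1 + i + lam))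
      = hahnCoeff lam k i n * (n - k) := by
  have hk : k - n = k - (n + 1) + 1 := by omega
  have hf : (n.factorial : ℂ) ≠ 0 := by exact_mod_cast n.factorial_ne_zero
  have hn : (n + 1 : ℂ) ≠ 0 := by exact_mod_cast n.succ_ne_zero
  rw [hahnCoeff, hahnCoeff, hk, poch_succ' (lam + i + 1 + n), poch_succ' (i - lam + n), poch_succ,
    Nat.factorial_succ]
  rw [show (lam + i + 1 + n + 1 : ℂ) = lam + i + 1 + (n + 1 : ℕ) by push_cast; ring,
    show (i - lam + n + 1 : ℂ) = i - lam + (n + 1 : ℕ) by push_cast; ring]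
  generalize poch (lam + i + 1 + (n + 1 : ℕ)) (k - (n + 1)) = a
  generalize poch (i - lam + (n + 1 : ℕ)) (k - (n + 1)) = b
  push_cast
  field_simp
  ring

theorem evenEigen_hahn (lam k i : ℕ) : EvenEigen lam i 0 (2 * k) (hahn lam k i) := by
  intro x
  let D : ℕ → ℂ := fun n =>
    -((wPoly lam).eval x * ((symBasis i n).eval (x + 1) - (symBasis i n).eval x) * (x - i - 1 / 2)
      + (wPoly lam).eval (x - 2 * i - 1)
        * ((symBasis i n).eval x - (symBasis i n).eval (x - 1)) * (x - i + 1 / 2))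
  have hD0 : D 0 = 0 := by simp [D, symBasis]
  have hD : ∀ n, D (n + 1) = 2 * (n + 1) * ((symBasis i (n + 1)).eval x
        - (n + i - lam) * (n + 1 + i + lam) * (symBasis i n).eval x) * ((x - i) ^ 2 - 1 / 4) :=
    fun n => evenOperator_symBasis lam i n x
  have hL : ∀ y, (hahn lam k i).eval y
      = ∑ n ∈ Finset.range (k + 1), hahnCoeff lam k i n * (symBasis i n).eval y := fun y => by
    simp [hahn, eval_finsetSum]
  have h1 : -((wPoly lam).eval x * ((hahn lam k i).eval (x + 1) - (hahn lam k i).eval x)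
        * (x - i - 1 / 2)
      + (wPoly lam).eval (x - 2 * i - 1) * ((hahn lam k i).eval x - (hahn lam k i).eval (x - 1))
        * (x - i + 1 / 2)) = ∑ n ∈ Finset.range (k + 1), hahnCoeff lam k i n * D n := by
    simp only [hL, D, ← Finset.sum_sub_distrib, Finset.mul_sum, Finset.sum_mul,
      ← Finset.sum_add_distrib, ← Finset.sum_neg_distrib]
    refine Finset.sum_congr rfl fun n _ => ?_
    ring
  -- By the recurrence each term is a telescoping difference plus `k` times the `n`-th term of the
  -- sum itself.
  have h2 : ∀ n ∈ Finset.range k, hahnCoeff lam k i (n + 1) * D (n + 1)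
      = 2 * ((x - i) ^ 2 - 1 / 4)
        * ((n + 1 : ℕ) * hahnCoeff lam k i (n + 1) * (symBasis i (n + 1)).eval x
          - n * hahnCoeff lam k i n * (symBasis i n).eval x
          + k * (hahnCoeff lam k i n * (symBasis i n).eval x)) := by
    intro n hn
    rw [hD]
    push_cast
    linear_combination -2 * ((x - i) ^ 2 - 1 / 4) * (symBasis i n).eval x
      * hahnCoeff_succ lam i (Finset.mem_range.1 hn)
  rw [h1, Finset.sum_range_succ', hD0, Finset.sum_congr rfl h2, ← Finset.mul_sum,
    Finset.sum_add_distrib,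
    Finset.sum_range_sub (fun n : ℕ => (n : ℂ) * hahnCoeff lam k i n * (symBasis i n).eval x),
    ← Finset.mul_sum, hL, Finset.sum_range_succ _ k]
  push_cast
  ring

theorem coeff_hahn (lam k i : ℕ) : (hahn lam k i).coeff (2 * k) = 1 := by
  have hf : (k.factorial : ℂ) ≠ 0 := by exact_mod_cast k.factorial_ne_zero
  rw [hahn, finsetSum_coeff, Finset.sum_range_succ, Finset.sum_eq_zero, coeff_C_mul,
    coeff_symBasis, hahnCoeff, Nat.sub_self, poch_zero, poch_zero, poch_neg_self,
    mul_div_cancel_right₀ _ hf, zero_add, mul_one, mul_one, ← mul_pow]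
  · norm_num
  · intro n hn
    rw [coeff_C_mul, coeff_eq_zero_of_natDegree_lt, mul_zero]
    have := Finset.mem_range.1 hn
    exact (natDegree_symBasis_le i n).trans_lt (by omega)

/-- Both sides are eigenfunctions for `2k + 2`, and `hahn` is monic, so the leading coefficient of
`brPoly` is the constant. -/
theorem brPoly_one_eq_hahn (lam k i : ℕ) :
    brPoly lam 1 k i = C (-poch (2 * i + k + 2) k) * hahn lam (k + 1) i := by
  have h1 := evenEigen_brPoly_one lam k i
  have h2 := (evenEigen_hahn lam (k + 1) i).C_mul (-poch (2 * i + k + 2) k)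
  rw [show (2 * k + 2 : ℂ) = (2 * k + 2 : ℕ) by push_cast; ring] at h1
  rw [show (2 * (k + 1 : ℕ) : ℂ) = (2 * k + 2 : ℕ) by push_cast; ring] at h2
  refine h1.ext h2 ?_
  rw [coeff_brPoly_one, coeff_quo_one, coeff_C_mul]
  have := coeff_hahn lam (k + 1) i
  rw [show 2 * (k + 1) = 2 * k + 2 from rfl] at this
  rw [this, mul_one]

theorem eval_brPoly_one (lam i : ℕ) (z : ℂ) {k : ℕ} (hk : 1 ≤ k) :
    (brPoly lam 1 (k - 1) i).eval z = -(poch (2 * i + k + 1) (k - 1)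
      * ∑ n ∈ Finset.range (k + 1), poch (-k) n * poch (i - z) n * poch (z - i) n
        / (n.factorial : ℂ) * poch (lam + i + 1 + n) (k - n) * poch (i - lam + n) (k - n)) := by
  obtain ⟨k, rfl⟩ := Nat.exists_eq_add_of_le' hk
  rw [Nat.add_sub_cancel, brPoly_one_eq_hahn, eval_mul, eval_C, hahn, eval_finsetSum, neg_mul]
  rw [show (2 * i + (k + 1 : ℕ) + 1 : ℂ) = 2 * i + k + 2 by push_cast; ring]
  congr 2
  refine Finset.sum_congr rfl fun n _ => ?_
  rw [eval_mul, eval_C, eval_symBasis, hahnCoeff]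
  ring

theorem poch_ne_zero_of {i lam k n : ℕ} (h : k + i ≤ lam) (hn : n ≤ k) :
    poch (i - lam) n ≠ 0 := by
  rw [poch, Finset.prod_ne_zero_iff]
  intro s hs hzero
  have hs' := Finset.mem_range.1 hs
  have : ((i + s : ℕ) : ℂ) = lam := by push_cast; linear_combination hzero
  have := Nat.cast_injective this
  omega

/-- The factor `(-k)_n` ends the series at `n = k`, and `k + i ≤ lam` keeps the lower Pochhammer
symbols nonzero up to there. -/
theorem eval_brPoly_one_hyp (i : ℕ) (z : ℂ) {lam k : ℕ} (hk : 1 ≤ k) (h : k + i ≤ lam) :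
    (brPoly lam 1 (k - 1) i).eval z =
      -(poch (2 * i + k + 1) (k - 1) * poch (lam + i + 1) k * poch (i - lam) k)
        * hyp3F2 (-k) (i - z) (z - i) (lam + i + 1) (i - lam) 1 := by
  rw [eval_brPoly_one lam i z hk, hyp3F2, tsum_eq_sum (s := Finset.range (k + 1)), neg_mul,
    neg_inj, Finset.mul_sum, Finset.mul_sum]
  · refine Finset.sum_congr rfl fun n hn => ?_
    have hn' : n ≤ k := Nat.lt_succ_iff.1 (Finset.mem_range.1 hn)
    have h1 : poch (lam + i + 1) n ≠ 0 := by
      rw [poch, Finset.prod_ne_zero_iff]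
      intro s _
      exact_mod_cast (by omega : lam + i + 1 + s ≠ 0)
    have h2 := poch_ne_zero_of h hn'
    have e1 := poch_add (lam + i + 1) n (k - n)
    have e2 := poch_add (i - lam) n (k - n)
    rw [Nat.add_sub_cancel' hn'] at e1 e2
    have hf : (n.factorial : ℂ) ≠ 0 := by exact_mod_cast n.factorial_ne_zero
    rw [e1, e2, one_pow]
    field_simp
  · intro n hn
    have : k < n := by simpa using hn
    rw [poch_neg_eq_zero this]
    simp

/-! ### Alternating sums -/

/-- The value at `x` of the polynomial `V^j U^j`. -/
noncomputable def weight (lam j : ℕ) (x : ℂ) : ℂ :=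
  ∏ s ∈ Finset.range j, (wPoly lam).eval (x - (s + 1))

/-- The supertrace of `p(H) V^j U^j`. -/
noncomputable def altSum (lam j : ℕ) (p : ℂ[X]) : ℂ :=
  ∑ a ∈ Finset.range (2 * lam + 1), (-1) ^ a * (p.eval (lam - a : ℂ) * weight lam j (lam - a))

theorem weight_succ (lam j : ℕ) (x : ℂ) :
    weight lam (j + 1) x = weight lam j x * (wPoly lam).eval (x - (j + 1)) := by
  rw [weight, Finset.prod_range_succ, ← weight]

theorem weight_succ' (lam j : ℕ) (x : ℂ) :
    weight lam (j + 1) x = (wPoly lam).eval (x - 1) * weight lam j (x - 1) := by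
  rw [weight, Finset.prod_range_succ', weight, mul_comm]
  congr 1
  · simp
  · refine Finset.prod_congr rfl fun s _ => ?_
    congr 1
    push_cast
    ring

theorem weight_reflect (lam j : ℕ) (x : ℂ) : weight lam j (j - x) = weight lam j x := by
  rw [weight, ← Finset.prod_range_reflect, weight]
  refine Finset.prod_congr rfl fun s hs => eval_wPoly_neg lam ?_
  have hs' := Finset.mem_range.1 hs
  have : ((j - 1 - s : ℕ) : ℂ) = j - 1 - s := by
    rw [Nat.sub_sub, Nat.cast_sub (by omega)]
    push_cast
    ring
  rw [this]
  ring

/-- The factor with `s = 2 * lam - a` is `w(-lam - 1) = 0`; this reflects that `U^j` kills the last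
`j` basis vectors. -/
theorem weight_eq_zero {lam j a : ℕ} (h1 : a ≤ 2 * lam) (h2 : 2 * lam < a + j) :
    weight lam j (lam - a) = 0 := by
  refine Finset.prod_eq_zero (i := 2 * lam - a) (Finset.mem_range.2 (by omega)) ?_
  rw [eval_wPoly, Nat.cast_sub h1]
  push_cast
  ring

theorem altSum_add (lam j : ℕ) (p q : ℂ[X]) :
    altSum lam j (p + q) = altSum lam j p + altSum lam j q := by
  rw [altSum, altSum, altSum, ← Finset.sum_add_distrib]
  refine Finset.sum_congr rfl fun a _ => ?_
  rw [eval_add]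
  ring

theorem altSum_C_mul (lam j : ℕ) (c : ℂ) (p : ℂ[X]) :
    altSum lam j (C c * p) = c * altSum lam j p := by
  rw [altSum, altSum, Finset.mul_sum]
  refine Finset.sum_congr rfl fun a _ => ?_
  rw [eval_mul, eval_C]
  ring

/-- The adjoint of the operator `raise`. -/
noncomputable def lower (s : ℂ) (g : ℂ[X]) : ℂ[X] := C s * g - g.comp (X + C (-1))

theorem eval_lower (s : ℂ) (g : ℂ[X]) (x : ℂ) :
    (lower s g).eval x = s * g.eval x - g.eval (x - 1) := by
  simp [lower, sub_eq_add_neg]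

/-- Abel summation: the summand of `raise` containing `h(x + 1)` is moved by one step, and the
alternating sign turns it into the minus sign in `lower`. -/
theorem altSum_raise_mul (lam j : ℕ) (s : ℂ) (h g : ℂ[X]) :
    altSum lam j (raise lam s (j + 1) h * g) = altSum lam (j + 1) (h * lower s g) := by
  let F : ℕ → ℂ := fun a =>
    (-1) ^ a * (h.eval (lam - a : ℂ) * g.eval (lam - a - 1 : ℂ) * weight lam (j + 1) (lam - a))
  let T : ℕ → ℂ := fun a => (-1) ^ a * (h.eval (lam - a + 1 : ℂ) * (wPoly lam).eval (lam - a : ℂ)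
    * g.eval (lam - a : ℂ) * weight lam j (lam - a))
  -- The boundary terms of the shift vanish: here because `w(lam) = 0`, and in `hF` because the
  -- weight is zero at the other end.
  have hT0 : T 0 = 0 := by simp [T, eval_wPoly]
  have hTF : ∀ a, T (a + 1) = -F a := by
    intro a
    simp only [T, F]
    rw [weight_succ', show (lam : ℂ) - (a + 1 : ℕ) + 1 = lam - a by push_cast; ring,
      show (lam : ℂ) - (a + 1 : ℕ) = lam - a - 1 by push_cast; ring, pow_succ]
    ring
  have hF : F (2 * lam) = 0 := by
    simp only [F]
    rw [weight_eq_zero le_rfl (by omega)]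
    ring
  have hsum : ∑ a ∈ Finset.range (2 * lam + 1), T a
      = -∑ a ∈ Finset.range (2 * lam + 1), F a := by
    rw [Finset.sum_range_succ', hT0, Finset.sum_range_succ F, hF, Finset.sum_congr rfl
      (fun a _ => hTF a), Finset.sum_neg_distrib]
    ring
  have h1 : altSum lam j (raise lam s (j + 1) h * g)
      = ∑ a ∈ Finset.range (2 * lam + 1), T a
        + s * ∑ a ∈ Finset.range (2 * lam + 1), (-1) ^ a
          * (h.eval (lam - a : ℂ) * g.eval (lam - a : ℂ) * weight lam (j + 1) (lam - a)) := by
    rw [altSum, Finset.mul_sum, ← Finset.sum_add_distrib]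
    refine Finset.sum_congr rfl fun a _ => ?_
    simp only [T]
    rw [eval_mul, eval_raise, weight_succ]
    push_cast
    ring
  rw [h1, hsum, altSum, Finset.mul_sum, ← Finset.sum_neg_distrib, ← Finset.sum_add_distrib]
  refine Finset.sum_congr rfl fun a _ => ?_
  simp only [F]
  rw [eval_mul, eval_lower]
  ring

theorem altSum_eq_sum_range_sub (lam j : ℕ) (p : ℂ[X]) :
    altSum lam j p = ∑ a ∈ Finset.range (2 * lam + 1 - j),
      (-1) ^ a * (p.eval (lam - a : ℂ) * weight lam j (lam - a)) := by
  refine (Finset.sum_subset (Finset.range_mono (Nat.sub_le _ _)) fun a ha hb => ?_).symm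
  rw [Finset.mem_range] at ha hb
  rw [weight_eq_zero (by omega) (by omega)]
  ring

theorem altSum_reflect (lam j : ℕ) {p : ℂ[X]} {e : ℂ}
    (h : ∀ x : ℂ, p.eval (j - x) = e * p.eval x) : altSum lam j p = (-1) ^ j * e * altSum lam j p := by
  -- On the indices `a ≤ 2 * lam - j` the reversal `a ↦ 2 * lam - j - a` sends `x = lam - a` to `j -
  -- x` and changes the sign by `(-1) ^ j`. The weight vanishes on the remaining indices.
  conv_lhs => rw [altSum_eq_sum_range_sub, ← Finset.sum_range_reflect]
  rw [altSum_eq_sum_range_sub, Finset.mul_sum]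
  refine Finset.sum_congr rfl fun a ha => ?_
  have ha' := Finset.mem_range.1 ha
  have hcast : (lam : ℂ) - (2 * lam + 1 - j - 1 - a : ℕ) = j - (lam - a) := by
    rw [Nat.cast_sub (by omega), Nat.cast_sub (by omega), Nat.cast_sub (by omega)]
    push_cast
    ring
  have hsign : (-1 : ℂ) ^ (2 * lam + 1 - j - 1 - a) = (-1) ^ j * (-1) ^ a := by
    rw [← pow_add]
    refine neg_one_pow_congr ?_
    rw [Nat.even_iff, Nat.even_iff]
    omega
  rw [hcast, hsign, h, weight_reflect]
  ring

theorem altSum_eq_zero_of_reflect (lam j : ℕ) {p : ℂ[X]}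
    (h : ∀ x : ℂ, p.eval (j - x) = -(-1) ^ j * p.eval x) : altSum lam j p = 0 := by
  have h1 := altSum_reflect lam j h
  have h2 : ((-1 : ℂ) ^ j) * (-1) ^ j = 1 := by rw [← mul_pow]; norm_num
  linear_combination 1 / 2 * h1 - 1 / 2 * altSum lam j p * h2

/-! ### The lowering operator: degrees, symmetry and divisibility -/

theorem natDegree_lower_one_le {g : ℂ[X]} {n : ℕ} (hg : g.natDegree ≤ n + 1) :
    (lower 1 g).natDegree ≤ n := by
  rw [lower, map_one, one_mul, ← neg_sub, natDegree_neg]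
  exact natDegree_comp_sub_self_le hg _

theorem coeff_lower_one {g : ℂ[X]} {n : ℕ} (hg : g.natDegree ≤ n + 1) :
    (lower 1 g).coeff n = (n + 1) * g.coeff (n + 1) := by
  rw [lower, map_one C, one_mul, ← neg_sub, coeff_neg, coeff_comp_sub_self hg]
  ring

theorem natDegree_lower_le (s : ℂ) {g : ℂ[X]} {n : ℕ} (hg : g.natDegree ≤ n) :
    (lower s g).natDegree ≤ n :=
  (natDegree_sub_le_of_le ((natDegree_C_mul_le _ _).trans hg)
    ((natDegree_comp_X_add_C g _).le.trans hg)).trans (max_self n).le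

theorem coeff_lower_neg_one {g : ℂ[X]} {n : ℕ} (hg : g.natDegree ≤ n) :
    (lower (-1) g).coeff n = -2 * g.coeff n := by
  rw [lower, coeff_sub, coeff_C_mul, coeff_comp_X_add_C_of_natDegree_le' hg]
  ring

theorem eval_lower_reflect {t e c : ℂ} (ht : t ^ 2 = 1) {g : ℂ[X]}
    (hg : ∀ x, g.eval (c - x) = e * g.eval x) (x : ℂ) :
    (lower t g).eval (c + 1 - x) = -(t * e) * (lower t g).eval x := by
  rw [eval_lower, eval_lower, show c + 1 - x = c - (x - 1) by ring, hg,
    show c - (x - 1) - 1 = c - x by ring, hg]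
  linear_combination e * g.eval x * ht

theorem exists_lower_eq_mul {s : ℂ} (hs : s ^ 2 = 1) {i : ℕ} {g : ℂ[X]}
    (hg : ∀ x : ℂ, g.eval (2 * i - x) = s * g.eval x) :
    ∃ r : ℂ[X], (X - C (i + 1 / 2 : ℂ)) * r = lower s g ∧
      ∀ x : ℂ, r.eval (2 * i + 1 - x) = r.eval x := by
  have h := eval_lower_reflect hs hg
  have h' : ∀ x : ℂ, (lower s g).eval (2 * i + 1 - x) = -1 * (lower s g).eval x := fun x => by
    rw [h]
    linear_combination -(lower s g).eval x * hs
  refine ⟨_, X_sub_C_mul_divByMonic_of_reflect fun x => by rw [h', neg_one_mul], fun x => ?_⟩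
  rw [eval_reflect_of_mul h' (X_sub_C_mul_divByMonic_of_reflect fun x => by rw [h', neg_one_mul]),
    neg_neg, one_mul]

/-- The linear factor of `lower s g` is handed to `quo`, where it cancels the division in the
recursion and exposes a second `raise`. -/
theorem altSum_brPoly_succ_mul {lam : ℕ} {s : ℂ} (hs : s ^ 2 = 1) (k i : ℕ) {g r : ℂ[X]}
    (hr : (X - C (i + 1 / 2 : ℂ)) * r = lower s g) :
    altSum lam (2 * i) (brPoly lam s (k + 1) i * g)
      = altSum lam (2 * (i + 1)) (brPoly lam s k (i + 1) * lower (-s) r) := by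
  rw [brPoly, altSum_raise_mul, ← hr, mul_left_comm, ← mul_assoc, X_sub_C_mul_quo_succ hs,
    altSum_raise_mul]
  rfl

theorem eq_C_mul_of_natDegree_le_one {r : ℂ[X]} {a : ℂ} (hr : r.natDegree ≤ 1)
    (h : r.eval a = 0) : r = C (r.coeff 1) * (X - C a) := by
  rw [eq_X_add_C_of_natDegree_le_one hr] at h
  conv_lhs => rw [eq_X_add_C_of_natDegree_le_one hr]
  simp only [eval_add, eval_mul, eval_C, eval_X] at h
  rw [eq_neg_of_add_eq_zero_right h, mul_sub, sub_eq_add_neg, C_neg, C_mul]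

/-! ### The alternating sums of the constant polynomial -/

/-- Up to a scalar, `X - (i + 1/2)` is `raise` of the constant `1` with `s = -1`, so the adjunction
moves it to index `2i + 2`. -/
theorem altSum_X_sub_C (lam i : ℕ) :
    (i + 1) * altSum lam (2 * i + 1) (X - C (i + 1 / 2 : ℂ)) = altSum lam (2 * i + 2) 1 := by
  have h := altSum_raise_mul lam (2 * i + 1) (-1) 1 1
  have h1 : raise lam (-1) (2 * i + 1 + 1) 1 * 1 = C (-(2 * i + 2) : ℂ) * (X - C (i + 1 / 2 : ℂ)) := by
    refine Polynomial.funext fun x => ?_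
    simp only [eval_mul, eval_raise, eval_wPoly, eval_one, eval_C, eval_sub, eval_X]
    push_cast
    ring
  have h2 : 1 * lower (-1) 1 = C (-2) * (1 : ℂ[X]) := by
    refine Polynomial.funext fun x => ?_
    simp only [eval_mul, eval_lower, eval_one, eval_C]
    ring
  rw [h1, h2, altSum_C_mul, altSum_C_mul] at h
  linear_combination -1 / 2 * h

theorem altSum_brPoly_zero_mul {lam i : ℕ} {s : ℂ} (hs : s ^ 2 = 1) {g : ℂ[X]}
    (hg : ∀ x : ℂ, g.eval (2 * i - x) = s * g.eval x) (hd : (lower s g).natDegree ≤ 1) :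
    (i + 1) * altSum lam (2 * i) (brPoly lam s 0 i * g)
      = (lower s g).coeff 1 * altSum lam (2 * i + 2) 1 := by
  obtain ⟨r, hr, -⟩ := exists_lower_eq_mul hs hg
  have h0 : (lower s g).eval (i + 1 / 2 : ℂ) = 0 := by rw [← hr]; simp
  rw [brPoly, altSum_raise_mul, quo, one_mul, eq_C_mul_of_natDegree_le_one hd h0, altSum_C_mul,
    ← altSum_X_sub_C, ← eq_C_mul_of_natDegree_le_one hd h0]
  ring

/-- The second moment of `X - i` is obtained twice: from `s = -1` paired with `X - i`, and from `s =
1` paired with `1`, where `lower` gives zero. Eliminating it leaves a recurrence for the sum of `1`.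
-/
theorem altSum_one_succ (lam i : ℕ) :
    altSum lam (2 * i + 2) 1
      = (i + 1) * (2 * i + 1) / 2 * ((lam - i) * (lam + i + 1)) * altSum lam (2 * i) 1 := by
  have hX : ∀ x : ℂ, (X - C (i : ℂ)).eval (2 * i - x) = -1 * (X - C (i : ℂ)).eval x := fun x => by
    simp only [eval_sub, eval_X, eval_C]
    ring
  have hXd : (X - C (i : ℂ)).natDegree ≤ 1 := natDegree_X_sub_C_le _
  have h1 := altSum_brPoly_zero_mul (lam := lam) (i := i) (s := -1) (by norm_num) hX
    (natDegree_lower_le _ hXd)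
  rw [coeff_lower_neg_one hXd] at h1
  have hd0 : (1 : ℂ[X]).natDegree ≤ 0 + 1 := by simp
  have h2 := altSum_brPoly_zero_mul (lam := lam) (i := i) (s := 1) (g := 1) (by norm_num)
    (fun x => by simp) ((natDegree_lower_one_le hd0).trans zero_le_one)
  rw [coeff_lower_one (by simp : (1 : ℂ[X]).natDegree ≤ 1 + 1)] at h2
  have e1 : brPoly lam (-1) 0 i * (X - C (i : ℂ)) = C (-(2 * i + 1) : ℂ) * (X - C (i : ℂ)) ^ 2 := by
    refine Polynomial.funext fun x => ?_
    simp only [brPoly, quo, eval_mul, eval_raise, eval_wPoly, eval_one, eval_C, eval_sub, eval_X,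
      eval_pow]
    push_cast
    ring
  have e2 : brPoly lam 1 0 i * 1
      = C (-1) * (X - C (i : ℂ)) ^ 2 + C ((lam - i) * (lam + i + 1) : ℂ) * 1 := by
    refine Polynomial.funext fun x => ?_
    simp only [brPoly, quo, eval_mul, eval_raise, eval_wPoly, eval_one, eval_C, eval_sub, eval_X,
      eval_pow, eval_add]
    push_cast
    ring
  have hc : (X - C (i : ℂ)).coeff 1 = 1 := by simp
  have hc' : (1 : ℂ[X]).coeff (1 + 1) = 0 := by simp [coeff_one]
  have hi : (i + 1 : ℂ) ≠ 0 := by exact_mod_cast i.succ_ne_zero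
  rw [e1, altSum_C_mul, hc] at h1
  rw [e2, altSum_add, altSum_C_mul, altSum_C_mul, hc', mul_zero, zero_mul, mul_eq_zero,
    or_iff_right hi] at h2
  linear_combination 1 / 2 * h1 - (i + 1) * (2 * i + 1) / 2 * h2

theorem altSum_zero_one (lam : ℕ) : altSum lam 0 1 = 1 := by
  have : ∀ n : ℕ, ∑ a ∈ Finset.range (2 * n + 1), (-1 : ℂ) ^ a = 1 := fun n => by
    induction n with
    | zero => simp
    | succ n ih =>
      rw [show 2 * (n + 1) + 1 = 2 * n + 1 + 1 + 1 by ring, Finset.sum_range_succ,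
        Finset.sum_range_succ, ih]
      ring
  simp [altSum, weight, this]

theorem altSum_one_ne_zero_iff (lam i : ℕ) : altSum lam (2 * i) 1 ≠ 0 ↔ i ≤ lam := by
  induction i with
  | zero => simp [altSum_zero_one]
  | succ i ih =>
    have h1 : ((i + 1) * (2 * i + 1) / 2 : ℂ) ≠ 0 := by
      refine div_ne_zero (mul_ne_zero ?_ ?_) two_ne_zero
      · exact_mod_cast i.succ_ne_zero
      · exact_mod_cast (2 * i).succ_ne_zero
    have h2 : (lam + i + 1 : ℂ) ≠ 0 := by exact_mod_cast (lam + i).succ_ne_zero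
    have h3 : (lam - i : ℂ) ≠ 0 ↔ lam ≠ i := by rw [sub_ne_zero, Nat.cast_injective.ne_iff]
    rw [show 2 * (i + 1) = 2 * i + 2 from rfl, altSum_one_succ, mul_ne_zero_iff, mul_ne_zero_iff,
      mul_ne_zero_iff, h3, ih]
    simp only [h1, h2, ne_eq, not_false_eq_true, true_and, and_true]
    omega

/-! ### Pairing with test polynomials of the same symmetry -/

theorem exists_altSum_brPoly_one (lam k i : ℕ) :
    ∃ N : ℂ, (N ≠ 0 ↔ k + i + 1 ≤ lam) ∧ ∀ g : ℂ[X], g.natDegree ≤ 2 * k + 2 →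
      (∀ x : ℂ, g.eval (2 * i - x) = g.eval x) →
      altSum lam (2 * i) (brPoly lam 1 k i * g) = g.coeff (2 * k + 2) * N := by
  induction k generalizing i with
  | zero =>
    have hi : (i + 1 : ℂ) ≠ 0 := by exact_mod_cast i.succ_ne_zero
    refine ⟨2 / (i + 1) * altSum lam (2 * i + 2) 1, ?_, fun g hd hg => ?_⟩
    · rw [mul_ne_zero_iff, show 2 * i + 2 = 2 * (i + 1) from rfl, altSum_one_ne_zero_iff, zero_add]
      simp [hi]
    · have h := altSum_brPoly_zero_mul (lam := lam) (i := i) (s := 1) (by norm_num)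
        (fun x => by rw [hg, one_mul]) (natDegree_lower_one_le hd)
      rw [coeff_lower_one hd] at h
      field_simp
      push_cast at h
      rw [mul_comm (altSum lam (2 * i) _), h]
      ring
  | succ k ih =>
    obtain ⟨N, hN, H⟩ := ih (i + 1)
    -- `lower 1` multiplies the leading coefficient by `2k + 4` and loses a degree, the division
    -- loses another, and `lower (-1)` multiplies by `-2`.
    refine ⟨-2 * (2 * k + 4) * N, ?_, fun g hd hg => ?_⟩
    · have : (-2 * (2 * k + 4) : ℂ) ≠ 0 :=
        mul_ne_zero (by norm_num) (by exact_mod_cast (by omega : 2 * k + 4 ≠ 0))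
      rw [mul_ne_zero_iff, hN]
      simp only [this, ne_eq, not_false_eq_true, true_and]
      omega
    · obtain ⟨r, hr, hrs⟩ := exists_lower_eq_mul (s := 1) (by norm_num) (i := i) (g := g)
        (fun x => by rw [hg, one_mul])
      have hd' : g.natDegree ≤ 2 * k + 2 + 1 + 1 := hd
      have hl := natDegree_lower_one_le hd'
      have hrd := natDegree_of_X_sub_C_mul_eq hr hl
      rw [altSum_brPoly_succ_mul (by norm_num) k i hr, H _ (natDegree_lower_le _ hrd),
        coeff_lower_neg_one hrd, coeff_of_X_sub_C_mul_eq hr hl, coeff_lower_one hd']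
      · push_cast
        ring_nf
      · intro x
        have := eval_lower_reflect (t := -1) (e := 1) (c := 2 * i + 1) (by norm_num)
          (fun x => by rw [hrs x, one_mul]) x
        rw [show 2 * ((i + 1 : ℕ) : ℂ) - x = 2 * i + 1 + 1 - x by push_cast; ring, this]
        ring

theorem exists_altSum_brPoly_neg_one (lam k i : ℕ) :
    ∃ N : ℂ, (N ≠ 0 ↔ k + i + 1 ≤ lam) ∧ ∀ g : ℂ[X], g.natDegree ≤ 2 * k + 1 →
      (∀ x : ℂ, g.eval (2 * i - x) = -1 * g.eval x) →
      altSum lam (2 * i) (brPoly lam (-1) k i * g) = g.coeff (2 * k + 1) * N := by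
  induction k generalizing i with
  | zero =>
    have hi : (i + 1 : ℂ) ≠ 0 := by exact_mod_cast i.succ_ne_zero
    refine ⟨-2 / (i + 1) * altSum lam (2 * i + 2) 1, ?_, fun g hd hg => ?_⟩
    · rw [mul_ne_zero_iff, show 2 * i + 2 = 2 * (i + 1) from rfl, altSum_one_ne_zero_iff, zero_add]
      simp [hi]
    · have h := altSum_brPoly_zero_mul (lam := lam) (i := i) (s := -1) (by norm_num)
        hg (natDegree_lower_le _ hd)
      rw [coeff_lower_neg_one hd] at h
      field_simp
      push_cast at h
      rw [mul_comm (altSum lam (2 * i) _), h]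
      ring
  | succ k ih =>
    obtain ⟨N, hN, H⟩ := ih (i + 1)
    -- The two operators now act in the opposite order: `lower (-1)` gives `-2`, and `lower 1` acts
    -- after the division, on degree `2k + 2`.
    refine ⟨-2 * (2 * k + 2) * N, ?_, fun g hd hg => ?_⟩
    · have : (-2 * (2 * k + 2) : ℂ) ≠ 0 :=
        mul_ne_zero (by norm_num) (by exact_mod_cast (by omega : 2 * k + 2 ≠ 0))
      rw [mul_ne_zero_iff, hN]
      simp only [this, ne_eq, not_false_eq_true, true_and]
      omega
    · obtain ⟨r, hr, hrs⟩ := exists_lower_eq_mul (s := -1) (by norm_num) (i := i) (g := g) hg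
      have hd' : g.natDegree ≤ 2 * k + 2 + 1 := hd
      have hl := natDegree_lower_le (-1) hd'
      have hrd : r.natDegree ≤ 2 * k + 1 + 1 := natDegree_of_X_sub_C_mul_eq hr hl
      rw [altSum_brPoly_succ_mul (by norm_num) k i hr, neg_neg, H _ (natDegree_lower_one_le hrd),
        coeff_lower_one hrd, coeff_of_X_sub_C_mul_eq hr hl, coeff_lower_neg_one hd']
      · push_cast
        ring_nf
      · intro x
        have := eval_lower_reflect (t := 1) (e := 1) (c := 2 * i + 1) (by norm_num)
          (fun x => by rw [hrs x, one_mul]) x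
        rw [show 2 * ((i + 1 : ℕ) : ℂ) - x = 2 * i + 1 + 1 - x by push_cast; ring, this]
        ring

/-! ### The polynomials `f_{l, j}` in closed form -/

/-- The polynomial `f_{l, j}`. -/
noncomputable def fPoly (lam l j : ℕ) : ℂ[X] :=
  if j % 2 = 0 then
    if l % 2 = 0 then
      if l = 0 then 1 else brPoly lam 1 (l / 2 - 1) (j / 2)
    else brPoly lam (-1) (l / 2) (j / 2)
  else
    if l % 2 = 0 then quo lam 1 (l / 2) (j / 2)
    else (X - C ((j / 2 : ℕ) + 1 / 2 : ℂ)) * quo lam 1 (l / 2) (j / 2)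

theorem fPoly_zero_even (lam i : ℕ) : fPoly lam 0 (2 * i) = 1 := by
  simp [fPoly]

theorem fPoly_even_even (lam k i : ℕ) : fPoly lam (2 * k + 2) (2 * i) = brPoly lam 1 k i := by
  simp [fPoly]

theorem fPoly_odd_even (lam k i : ℕ) : fPoly lam (2 * k + 1) (2 * i) = brPoly lam (-1) k i := by
  have h1 : (2 * k + 1) / 2 = k := by omega
  simp [fPoly, h1]

theorem fPoly_even_odd (lam k i : ℕ) : fPoly lam (2 * k) (2 * i + 1) = quo lam 1 k i := by
  have h2 : (2 * i + 1) / 2 = i := by omega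
  simp [fPoly, h2]

theorem fPoly_odd_odd (lam k i : ℕ) :
    fPoly lam (2 * k + 1) (2 * i + 1) = (X - C (i + 1 / 2 : ℂ)) * quo lam 1 k i := by
  have h1 : (2 * k + 1) / 2 = k := by omega
  have h2 : (2 * i + 1) / 2 = i := by omega
  simp [fPoly, h1, h2]

theorem degree_eq_of_natDegree_le_of_coeff {p : ℂ[X]} {n : ℕ} (h : p.natDegree ≤ n)
    (hc : p.coeff n ≠ 0) : p.degree = n :=
  degree_eq_of_le_of_coeff_ne_zero (natDegree_le_iff_degree_le.1 h) hc

theorem degree_fPoly_even (lam l i : ℕ) : (fPoly lam l (2 * i)).degree = l := by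
  obtain ⟨k, rfl | rfl⟩ := Nat.even_or_odd' l
  · cases k with
    | zero => simp [fPoly_zero_even]
    | succ k =>
      rw [show 2 * (k + 1) = 2 * k + 2 from rfl, fPoly_even_even]
      exact degree_eq_of_natDegree_le_of_coeff (natDegree_brPoly_one_le lam k i)
        (coeff_brPoly_one_ne_zero lam k i)
  · rw [fPoly_odd_even]
    exact degree_eq_of_natDegree_le_of_coeff (natDegree_brPoly_neg_one_le lam k i)
      (coeff_brPoly_neg_one_ne_zero lam k i)

theorem degree_quo_one (lam k i : ℕ) : (quo lam 1 k i).degree = (2 * k : ℕ) :=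
  degree_eq_of_natDegree_le_of_coeff (natDegree_quo_one_le lam k i) (coeff_quo_one_ne_zero lam k i)

theorem degree_fPoly_odd (lam l i : ℕ) : (fPoly lam l (2 * i + 1)).degree = l := by
  obtain ⟨k, rfl | rfl⟩ := Nat.even_or_odd' l
  · rw [fPoly_even_odd, degree_quo_one]
  · rw [fPoly_odd_odd, degree_mul, degree_X_sub_C, degree_quo_one, add_comm]
    push_cast
    rfl

/-! ### Orthogonality and norms for even index -/

theorem eval_fPoly_even_reflect (lam l i : ℕ) (x : ℂ) :
    (fPoly lam l (2 * i)).eval (2 * i - x) = (-1) ^ l * (fPoly lam l (2 * i)).eval x := by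
  obtain ⟨k, rfl | rfl⟩ := Nat.even_or_odd' l
  · rw [pow_mul, neg_one_sq, one_pow]
    cases k with
    | zero => simp [fPoly_zero_even]
    | succ k =>
      rw [show 2 * (k + 1) = 2 * k + 2 from rfl, fPoly_even_even]
      exact eval_brPoly_reflect (by norm_num) k i x
  · rw [pow_succ, pow_mul, neg_one_sq, one_pow, one_mul, fPoly_odd_even]
    exact eval_brPoly_reflect (by norm_num) k i x

theorem exists_altSum_fPoly_of_reflect (lam l i : ℕ) :
    ∃ N : ℂ, (N ≠ 0 ↔ l + 2 * i ≤ 2 * lam) ∧ ∀ g : ℂ[X], g.natDegree ≤ l →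
      (∀ x : ℂ, g.eval (2 * i - x) = (-1) ^ l * g.eval x) →
      altSum lam (2 * i) (fPoly lam l (2 * i) * g) = g.coeff l * N := by
  obtain ⟨k, rfl | rfl⟩ := Nat.even_or_odd' l
  · rw [pow_mul, neg_one_sq, one_pow]
    cases k with
    | zero =>
      refine ⟨altSum lam (2 * i) 1, ?_, fun g hg _ => ?_⟩
      · rw [altSum_one_ne_zero_iff]
        omega
      · rw [mul_zero] at hg ⊢
        rw [fPoly_zero_even, one_mul, eq_C_of_natDegree_le_zero hg, ← mul_one (C _), altSum_C_mul]
        simp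
    | succ k =>
      obtain ⟨N, hN, H⟩ := exists_altSum_brPoly_one lam k i
      rw [show 2 * (k + 1) = 2 * k + 2 from rfl, fPoly_even_even]
      refine ⟨N, hN.trans (by omega), fun g hd hg => H g hd fun x => ?_⟩
      rw [hg, one_mul]
  · rw [pow_succ, pow_mul, neg_one_sq, one_pow, one_mul, fPoly_odd_even]
    obtain ⟨N, hN, H⟩ := exists_altSum_brPoly_neg_one lam k i
    exact ⟨N, hN.trans (by omega), H⟩

theorem natDegree_comp_C_sub_X_le {g : ℂ[X]} {n : ℕ} (hg : g.natDegree ≤ n) (c : ℂ) :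
    (g.comp (C c - X)).natDegree ≤ n := by
  refine natDegree_comp_le.trans ?_
  have : (C c - X).natDegree ≤ 1 := by compute_degree
  calc g.natDegree * (C c - X).natDegree ≤ g.natDegree * 1 := Nat.mul_le_mul_left _ this
    _ ≤ n := by omega

theorem coeff_comp_C_sub_X {g : ℂ[X]} {n : ℕ} (hg : g.natDegree ≤ n) (c : ℂ) :
    (g.comp (C c - X)).coeff n = (-1) ^ n * g.coeff n := by
  have h : g.comp (C c - X) = (g.comp (-X)).comp (X + C (-c)) := by
    rw [comp_assoc]
    congr 1
    simp
    ring
  have hd : (g.comp (-X)).natDegree ≤ n := by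
    have := natDegree_comp_C_sub_X_le hg 0
    rwa [C_0, zero_sub] at this
  rw [h, coeff_comp_X_add_C_of_natDegree_le' hd, ← neg_one_mul, ← C_1, ← C_neg,
    comp_C_mul_X_coeff, mul_comm]

/-- A single constant `N` controls every pairing with degree at most `l`: vanishing of the `l`-th
coefficient gives orthogonality, and `N ≠ 0` decides the norm. -/
theorem exists_altSum_fPoly (lam l i : ℕ) :
    ∃ N : ℂ, (N ≠ 0 ↔ l + 2 * i ≤ 2 * lam) ∧ ∀ g : ℂ[X], g.natDegree ≤ l →
      altSum lam (2 * i) (fPoly lam l (2 * i) * g) = g.coeff l * N := by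
  obtain ⟨N, hN, H⟩ := exists_altSum_fPoly_of_reflect lam l i
  refine ⟨N, hN, fun g hg => ?_⟩
  have hsq : ((-1 : ℂ) ^ l) * (-1) ^ l = 1 := by rw [← mul_pow]; norm_num
  have hd := natDegree_comp_C_sub_X_le hg (2 * i)
  set r := g.comp (C (2 * i : ℂ) - X) with hr
  have hre : ∀ x : ℂ, r.eval x = g.eval (2 * i - x) := fun x => by simp [hr]
  have hre' : ∀ x : ℂ, r.eval (2 * i - x) = g.eval x := fun x => by rw [hre, sub_sub_cancel]
  have hrc : r.coeff l = (-1) ^ l * g.coeff l := coeff_comp_C_sub_X hg _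
  -- The test polynomial splits under `x ↦ 2i - x` into a part with the symmetry of `fPoly` and a
  -- part with the opposite one, whose pairing vanishes.
  have hdec : fPoly lam l (2 * i) * g
      = fPoly lam l (2 * i) * (C (1 / 2) * (g + C ((-1) ^ l) * r))
        + fPoly lam l (2 * i) * (C (1 / 2) * (g - C ((-1) ^ l) * r)) := by
    refine Polynomial.funext fun x => ?_
    simp only [eval_add, eval_mul, eval_sub, eval_C]
    ring
  have hanti : altSum lam (2 * i) (fPoly lam l (2 * i) * (C (1 / 2) * (g - C ((-1) ^ l) * r)))
      = 0 := by
    refine altSum_eq_zero_of_reflect lam _ fun x => ?_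
    rw [pow_mul, neg_one_sq, one_pow]
    push_cast
    simp only [eval_mul, eval_sub, eval_C, eval_fPoly_even_reflect, hre', ← hre]
    linear_combination -(fPoly lam l (2 * i)).eval x * (1 / 2) * g.eval x * hsq
  rw [hdec, altSum_add, hanti, add_zero, H]
  · rw [coeff_C_mul, coeff_add, coeff_C_mul, hrc]
    linear_combination 1 / 2 * g.coeff l * N * hsq
  · exact (natDegree_C_mul_le _ _).trans
      (natDegree_add_le_of_degree_le hg ((natDegree_C_mul_le _ _).trans hd))
  · intro x
    simp only [eval_mul, eval_add, eval_C, hre', ← hre]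
    linear_combination -(1 / 2) * r.eval x * hsq

theorem altSum_fPoly_mul_eq_zero (lam i : ℕ) {l : ℕ} {g : ℂ[X]} (hg : g.degree < l) :
    altSum lam (2 * i) (fPoly lam l (2 * i) * g) = 0 := by
  obtain ⟨N, -, H⟩ := exists_altSum_fPoly lam l i
  rw [H g (natDegree_le_iff_degree_le.2 hg.le), coeff_eq_zero_of_degree_lt hg, zero_mul]

theorem altSum_fPoly_sq_ne_zero_iff (lam l i : ℕ) :
    altSum lam (2 * i) (fPoly lam l (2 * i) * fPoly lam l (2 * i)) ≠ 0 ↔ l + 2 * i ≤ 2 * lam := by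
  obtain ⟨N, hN, H⟩ := exists_altSum_fPoly lam l i
  have hd := degree_fPoly_even lam l i
  rw [H _ (natDegree_eq_of_degree_eq_some hd).le, mul_ne_zero_iff, hN, and_iff_right]
  exact coeff_ne_zero_of_eq_degree hd

/-! ### Pairings for odd index -/

/-- For positive degree the left factor is `raise` of an even-index polynomial of index `2i + 2`, so
one adjunction reduces to the even case. -/
theorem altSum_X_sub_C_mul_quo (lam i k : ℕ) :
    ∃ N : ℂ, (N ≠ 0 ↔ k + i + 1 ≤ lam) ∧ ∀ g : ℂ[X], g.natDegree ≤ 2 * k →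
      altSum lam (2 * i + 1) ((X - C (i + 1 / 2 : ℂ)) * quo lam 1 k i * g) = g.coeff (2 * k) * N := by
  cases k with
  | zero =>
    have hi : (i + 1 : ℂ) ≠ 0 := by exact_mod_cast i.succ_ne_zero
    refine ⟨altSum lam (2 * i + 1) (X - C (i + 1 / 2 : ℂ)), ?_, fun g hg => ?_⟩
    · have h := altSum_X_sub_C lam i
      have h1 := altSum_one_ne_zero_iff lam (i + 1)
      rw [show 2 * (i + 1) = 2 * i + 2 from rfl, ← h, mul_ne_zero_iff, and_iff_right hi] at h1
      rw [h1, zero_add]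
    · rw [mul_zero] at hg ⊢
      rw [quo, mul_one, eq_C_of_natDegree_le_zero hg, mul_comm _ (C _), altSum_C_mul, coeff_C_zero]
  | succ k =>
    obtain ⟨N, hN, H⟩ := exists_altSum_fPoly lam (2 * k + 2) (i + 1)
    refine ⟨-2 * N, ?_, fun g hg => ?_⟩
    · rw [mul_ne_zero_iff, hN, and_iff_right (by norm_num)]
      omega
    · have hg' : g.natDegree ≤ 2 * k + 2 := hg
      rw [X_sub_C_mul_quo_succ (by norm_num), altSum_raise_mul, ← fPoly_even_even,
        show 2 * i + 1 + 1 = 2 * (i + 1) from rfl, H _ (natDegree_lower_le _ hg'),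
        coeff_lower_neg_one hg', show 2 * (k + 1) = 2 * k + 2 from rfl]
      ring

theorem altSum_quo_mul_quo (lam i k m : ℕ) :
    altSum lam (2 * i + 1) ((X - C (i + 1 / 2 : ℂ)) * quo lam 1 k i * quo lam 1 m i) ≠ 0 ↔
      k = m ∧ k + i + 1 ≤ lam := by
  have hlt : ∀ k m, m < k →
      altSum lam (2 * i + 1) ((X - C (i + 1 / 2 : ℂ)) * quo lam 1 k i * quo lam 1 m i) = 0 := by
    intro k m hmk
    obtain ⟨N, -, H⟩ := altSum_X_sub_C_mul_quo lam i k
    have hd := natDegree_quo_one_le lam m i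
    rw [H _ (by omega), coeff_eq_zero_of_natDegree_lt (by omega), zero_mul]
  rcases lt_trichotomy k m with h | rfl | h
  · rw [mul_right_comm, hlt m k h]
    simp [h.ne]
  · obtain ⟨N, hN, H⟩ := altSum_X_sub_C_mul_quo lam i k
    rw [H _ (natDegree_quo_one_le lam k i), mul_ne_zero_iff, hN]
    simp [coeff_quo_one_ne_zero]
  · rw [hlt k m h]
    simp [h.ne']

theorem pair_eq_iff_even_odd (k m n : ℕ) :
    ({2 * k, 2 * m + 1} : Set ℕ) = {2 * n, 2 * n + 1} ↔ k = n ∧ m = n := by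
  rw [Set.pair_eq_pair_iff]
  omega

/-- If `l` and `m` have equal parity, the product is symmetric about `i + 1/2`; for odd index the
reversed alternating sum then equals its own negative. Mixed parity is `altSum_quo_mul_quo`. -/
theorem altSum_fPoly_odd_ne_zero_iff (lam l m i : ℕ) :
    altSum lam (2 * i + 1) (fPoly lam l (2 * i + 1) * fPoly lam m (2 * i + 1)) ≠ 0 ↔
      ∃ k : ℕ, ({l, m} : Set ℕ) = {2 * k, 2 * k + 1} ∧ k + i + 1 ≤ lam := by
  have hq : ∀ k : ℕ, ∀ x : ℂ, (quo lam 1 k i).eval ((2 * i + 1 : ℕ) - x) = (quo lam 1 k i).eval x :=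
    fun k x => by
      push_cast
      exact eval_quo_reflect (by norm_num) k i x
  have hsign : (-1 : ℂ) ^ (2 * i + 1) = -1 := by rw [pow_succ, pow_mul, neg_one_sq]; simp
  have heo : ∀ k n : ℕ, (∃ a : ℕ, ({2 * k, 2 * n + 1} : Set ℕ) = {2 * a, 2 * a + 1} ∧ a + i + 1 ≤ lam)
      ↔ k = n ∧ k + i + 1 ≤ lam := fun k n => by
    simp only [pair_eq_iff_even_odd]
    constructor
    · rintro ⟨a, ⟨rfl, rfl⟩, h⟩
      exact ⟨rfl, h⟩
    · rintro ⟨rfl, h⟩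
      exact ⟨k, ⟨rfl, rfl⟩, h⟩
  obtain ⟨k, rfl | rfl⟩ := Nat.even_or_odd' l <;> obtain ⟨n, rfl | rfl⟩ := Nat.even_or_odd' m
  · rw [fPoly_even_odd, fPoly_even_odd, altSum_eq_zero_of_reflect]
    · simp only [ne_eq, not_true_eq_false, false_iff, Set.pair_eq_pair_iff]
      omega
    · intro x
      rw [eval_mul, eval_mul, hq, hq, hsign]
      ring
  · rw [fPoly_even_odd, fPoly_odd_odd, mul_left_comm, ← mul_assoc,
      altSum_quo_mul_quo, heo]
  · rw [fPoly_even_odd, fPoly_odd_odd, Set.pair_comm, heo, altSum_quo_mul_quo]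
    constructor <;> rintro ⟨rfl, h⟩ <;> exact ⟨rfl, h⟩
  · rw [fPoly_odd_odd, fPoly_odd_odd, altSum_eq_zero_of_reflect]
    · simp only [ne_eq, not_true_eq_false, false_iff, Set.pair_eq_pair_iff]
      omega
    · intro x
      simp only [eval_mul, hq, hsign, eval_sub, eval_X, eval_C]
      push_cast
      ring

/-! ### The nested brackets -/

section Algebra

variable {A : Type} [Ring A] [Algebra ℂ A]

theorem SemiconjBy.aeval_right {a x y : A} (h : SemiconjBy a x y) (f : ℂ[X]) :
    a * aeval x f = aeval y f * a := by
  induction f using Polynomial.induction_on' with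
  | add p q hp hq => rw [map_add, map_add, mul_add, add_mul, hp, hq]
  | monomial n c =>
    rw [aeval_monomial, aeval_monomial, ← mul_assoc, ← Algebra.commutes, mul_assoc,
      (h.pow_right n).eq, mul_assoc]

namespace IsTriple

variable {lam : ℕ} {U V H : A}

theorem semiconjBy_V (T : IsTriple lam U V H) : SemiconjBy V H (H - 1) := by
  rw [SemiconjBy, sub_mul, one_mul, sub_eq_iff_eq_add.1 T.HV, add_sub_cancel_left]

theorem semiconjBy_V_pow (T : IsTriple lam U V H) (m : ℕ) : SemiconjBy (V ^ m) H (H - (m : A)) := by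
  induction m with
  | zero => simp
  | succ m ih =>
    rw [pow_succ, Nat.cast_succ, ← sub_sub]
    exact (ih.sub_right (SemiconjBy.one_right _)).mul_left T.semiconjBy_V

theorem semiconjBy_U (T : IsTriple lam U V H) : SemiconjBy U H (H + 1) := by
  rw [SemiconjBy, add_mul, one_mul, ← sub_eq_iff_eq_add', ← neg_sub, T.HU, neg_neg]

theorem U_mul_aeval (T : IsTriple lam U V H) (f : ℂ[X]) :
    U * aeval H f = aeval H (f.comp (X + C 1)) * U := by
  rw [SemiconjBy.aeval_right T.semiconjBy_U, aeval_comp]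
  simp

theorem V_pow_mul_aeval (T : IsTriple lam U V H) (m : ℕ) (f : ℂ[X]) :
    V ^ m * aeval H f = aeval H (f.comp (X + C (-(m : ℂ)))) * V ^ m := by
  rw [SemiconjBy.aeval_right (T.semiconjBy_V_pow m), aeval_comp]
  simp [sub_eq_add_neg]

theorem U_mul_V (T : IsTriple lam U V H) : U * V = aeval H (wPoly lam) := by
  have : wPoly lam = C (1 / 2) * (C (lam * (lam + 1) : ℂ) - X ^ 2 - X) := by
    refine Polynomial.funext fun x => ?_
    simp only [eval_wPoly, eval_mul, eval_sub, eval_C, eval_X, eval_pow]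
    ring
  rw [T.UV, this, map_mul (aeval H), aeval_C, map_sub, map_sub, map_pow, aeval_X, aeval_C,
    Algebra.smul_def]

theorem V_mul_U (T : IsTriple lam U V H) :
    V * U = aeval H ((wPoly lam).comp (X + C (-1))) := by
  have : (wPoly lam).comp (X + C (-1)) = C (1 / 2) * (C (lam * (lam + 1) : ℂ) - X ^ 2 + X) := by
    refine Polynomial.funext fun x => ?_
    simp only [eval_comp, eval_wPoly, eval_mul, eval_sub, eval_add, eval_C, eval_X, eval_pow]
    ring
  rw [T.VU, this, map_mul (aeval H), aeval_C, map_add, map_sub, map_pow, aeval_X, aeval_C,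
    Algebra.smul_def]

theorem U_mul_aeval_mul_V_pow (T : IsTriple lam U V H) (f : ℂ[X]) (m : ℕ) :
    U * (aeval H f * V ^ (m + 1)) = aeval H (f.comp (X + C 1) * wPoly lam) * V ^ m := by
  rw [← mul_assoc, T.U_mul_aeval, pow_succ', mul_assoc, ← mul_assoc U, T.U_mul_V, map_mul,
    mul_assoc]

theorem aeval_mul_V_pow_mul_U (T : IsTriple lam U V H) (f : ℂ[X]) (m : ℕ) :
    aeval H f * V ^ (m + 1) * U
      = aeval H (f * (wPoly lam).comp (X + C (-((m + 1 : ℕ) : ℂ)))) * V ^ m := by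
  rw [pow_succ, mul_assoc, mul_assoc, T.V_mul_U, T.V_pow_mul_aeval, map_mul, mul_assoc, comp_assoc]
  congr 4
  simp only [add_comp, X_comp, C_comp, Nat.cast_succ, neg_add, C_add]
  ring

theorem sub_eq_raise (T : IsTriple lam U V H) (f : ℂ[X]) (m : ℕ) :
    U * (aeval H f * V ^ (m + 1)) - aeval H f * V ^ (m + 1) * U
      = aeval H (raise lam (-1) (m + 1) f) * V ^ m := by
  rw [T.U_mul_aeval_mul_V_pow, T.aeval_mul_V_pow_mul_U, ← sub_mul, ← map_sub, raise,
    show (C (-1) : ℂ[X]) = -1 by simp, neg_one_mul, ← sub_eq_add_neg]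

theorem add_eq_raise (T : IsTriple lam U V H) (f : ℂ[X]) (m : ℕ) :
    U * (aeval H f * V ^ (m + 1)) + aeval H f * V ^ (m + 1) * U
      = aeval H (raise lam 1 (m + 1) f) * V ^ m := by
  rw [T.U_mul_aeval_mul_V_pow, T.aeval_mul_V_pow_mul_U, ← add_mul, ← map_add, raise, map_one C,
    one_mul, ← map_one C]

theorem den_eq_aeval (H : A) (i : ℕ) : den H i = aeval H (X - C (i + 1 / 2 : ℂ)) := by
  rw [den, map_sub, aeval_X, aeval_C]

theorem inverse_den_mul (T : IsTriple lam U V H) (i : ℕ) {q t : ℂ[X]}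
    (h : (X - C (i + 1 / 2 : ℂ)) * q = t) (y : A) :
    Ring.inverse (den H i) * (aeval H t * y) = aeval H q * y := by
  have hu : IsUnit (den H i) := by
    have := T.unit i
    rwa [Int.cast_natCast] at this
  rw [← h, map_mul, ← den_eq_aeval, mul_assoc, ← mul_assoc, Ring.inverse_mul_cancel _ hu, one_mul]

theorem inverse_den_mul_sbr (T : IsTriple lam U V H) (k i : ℕ) :
    Ring.inverse (den H i) * sbr 1 0 U (aeval H (brPoly lam 1 k (i + 1)) * V ^ (2 * (i + 1)))
      = aeval H (quo lam 1 (k + 1) i) * V ^ (2 * i + 1) := by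
  rw [sbr, mul_zero, pow_zero, one_mul, show 2 * (i + 1) = 2 * i + 1 + 1 from rfl, T.sub_eq_raise,
    T.inverse_den_mul i (X_sub_C_mul_quo_succ (by norm_num) k i)]

theorem sbr_quo (T : IsTriple lam U V H) (k i : ℕ) :
    sbr 1 1 U (aeval H (quo lam 1 k i) * V ^ (2 * i + 1))
      = aeval H (brPoly lam 1 k i) * V ^ (2 * i) := by
  rw [sbr, mul_one, pow_one, neg_one_mul, sub_neg_eq_add, T.add_eq_raise, brPoly]

/-- The shifted parity in `{·,·}` exchanges commutator and anticommutator, so the odd-degree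
recursion is the even-degree one with `s = -1`. -/
theorem inverse_den_mul_abr (T : IsTriple lam U V H) (k i : ℕ) :
    Ring.inverse (den H i) * abr 1 0 U (aeval H (brPoly lam (-1) k (i + 1)) * V ^ (2 * (i + 1)))
      = aeval H (quo lam (-1) (k + 1) i) * V ^ (2 * i + 1) := by
  have h := X_sub_C_mul_quo_succ (lam := lam) (s := -1) (by norm_num) k i
  rw [neg_neg] at h
  rw [abr, zero_add, mul_one, pow_one, neg_one_mul, sub_neg_eq_add,
    show 2 * (i + 1) = 2 * i + 1 + 1 from rfl, T.add_eq_raise, T.inverse_den_mul i h]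

theorem abr_quo (T : IsTriple lam U V H) (k i : ℕ) :
    abr 1 1 U (aeval H (quo lam (-1) k i) * V ^ (2 * i + 1))
      = aeval H (brPoly lam (-1) k i) * V ^ (2 * i) := by
  rw [abr, one_mul, neg_one_sq, one_mul, T.sub_eq_raise, brPoly]

theorem evenEven_succ (T : IsTriple lam U V H) (k i : ℕ) :
    evenEven U V H (k + 1) i = aeval H (brPoly lam 1 k i) * V ^ (2 * i) := by
  induction k generalizing i with
  | zero => rw [← T.sbr_quo, evenEven, quo, map_one, one_mul]
  | succ k ih => rw [evenEven, ih, T.inverse_den_mul_sbr, T.sbr_quo]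

theorem oddEven_eq (T : IsTriple lam U V H) (k i : ℕ) :
    oddEven U V H k i = aeval H (brPoly lam (-1) k i) * V ^ (2 * i) := by
  induction k generalizing i with
  | zero => rw [← T.abr_quo, oddEven, quo, map_one, one_mul]
  | succ k ih => rw [oddEven, ih, T.inverse_den_mul_abr, T.abr_quo]

theorem evenOdd_eq (T : IsTriple lam U V H) (k i : ℕ) :
    evenOdd U V H k i = aeval H (quo lam 1 k i) * V ^ (2 * i + 1) := by
  cases k with
  | zero => rw [evenOdd, quo, map_one, one_mul]
  | succ k => rw [evenOdd, T.evenEven_succ, T.inverse_den_mul_sbr]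

theorem nested_eq (T : IsTriple lam U V H) (l j : ℕ) :
    aeval H (fPoly lam l j) * V ^ j = nested U V H l j := by
  have hodd : ∀ n : ℕ, (2 * n + 1) % 2 ≠ 0 := fun n => by omega
  have hhalf : ∀ n : ℕ, (2 * n + 1) / 2 = n := fun n => by omega
  have heven : ∀ n : ℕ, 2 * n % 2 = 0 := fun n => by omega
  have hhalf' : ∀ n : ℕ, 2 * n / 2 = n := fun n => by omega
  obtain ⟨i, rfl | rfl⟩ := Nat.even_or_odd' j <;> obtain ⟨k, rfl | rfl⟩ := Nat.even_or_odd' l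
  · rw [nested, if_pos (heven i), if_pos (heven k), hhalf', hhalf']
    cases k with
    | zero => rw [fPoly_zero_even, map_one, one_mul, evenEven]
    | succ k => rw [show 2 * (k + 1) = 2 * k + 2 from rfl, fPoly_even_even, T.evenEven_succ]
  · rw [nested, if_pos (heven i), if_neg (hodd k), hhalf, hhalf', fPoly_odd_even, T.oddEven_eq]
  · rw [nested, if_neg (hodd i), if_pos (heven k), hhalf, hhalf', fPoly_even_odd, T.evenOdd_eq]
  · rw [nested, if_neg (hodd i), if_neg (hodd k), hhalf, hhalf, fPoly_odd_odd, T.evenOdd_eq,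
      map_mul, ← den_eq_aeval, mul_assoc]

end IsTriple

end Algebra

theorem isF_fPoly (lam l j : ℕ) : IsF lam l j (fPoly lam l j) :=
  fun _ _ _ _ _ _ T => T.nested_eq l j

/-! ### Uniqueness -/

/-- Multiplication by a sequence. -/
def seqMul (a : ℤ → ℂ) : Module.End ℂ (ℤ → ℂ) := LinearMap.mulLeft ℂ a

/-- The shift `φ ↦ φ(· + c)` of sequences. -/
def seqShift (c : ℤ) : Module.End ℂ (ℤ → ℂ) := LinearMap.funLeft ℂ ℂ (fun n => n + c)

theorem seqMul_apply (a φ : ℤ → ℂ) (n : ℤ) : seqMul a φ n = a n * φ n := rfl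

theorem seqShift_apply (c : ℤ) (φ : ℤ → ℂ) (n : ℤ) : seqShift c φ n = φ (n + c) := rfl

/-- A model in which `H` acts on sequences with every integer as an eigenvalue. Half-integers are
not eigenvalues, so the required inverses are multiplications by reciprocals. -/
theorem isTriple_seq (lam : ℕ) :
    IsTriple lam (seqMul (fun n => (wPoly lam).eval (n : ℂ)) * seqShift 1) (seqShift (-1))
      (seqMul fun n => (n : ℂ)) where
  HU := by
    refine LinearMap.ext fun φ => funext fun n => ?_
    simp only [LinearMap.sub_apply, LinearMap.neg_apply, Module.End.mul_apply, Pi.sub_apply,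
      Pi.neg_apply, seqMul_apply, seqShift_apply]
    push_cast
    ring
  HV := by
    refine LinearMap.ext fun φ => funext fun n => ?_
    simp only [LinearMap.sub_apply, Module.End.mul_apply, Pi.sub_apply, seqMul_apply,
      seqShift_apply]
    push_cast
    ring
  VU := by
    refine LinearMap.ext fun φ => funext fun n => ?_
    simp only [LinearMap.sub_apply, LinearMap.add_apply, LinearMap.smul_apply,
      Module.End.mul_apply, Pi.sub_apply, Pi.add_apply, Pi.smul_apply, pow_two, smul_eq_mul,
      Module.algebraMap_end_apply, seqMul_apply, seqShift_apply, eval_wPoly, neg_add_cancel_right]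
    push_cast
    ring
  UV := by
    refine LinearMap.ext fun φ => funext fun n => ?_
    simp only [LinearMap.sub_apply, LinearMap.smul_apply,
      Module.End.mul_apply, Pi.sub_apply, Pi.smul_apply, pow_two, smul_eq_mul,
      Module.algebraMap_end_apply, seqMul_apply, seqShift_apply, eval_wPoly, add_neg_cancel_right]
    ring
  unit := fun n => by
    have hne : ∀ m : ℤ, (m : ℂ) - (n + 1 / 2) ≠ 0 := fun m h => by
      have : ((2 * m : ℤ) : ℂ) = (2 * n + 1 : ℤ) := by
        push_cast
        linear_combination 2 * h
      have := Int.cast_injective this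
      omega
    refine ⟨⟨_, seqMul fun m => ((m : ℂ) - (n + 1 / 2))⁻¹, ?_, ?_⟩, rfl⟩ <;>
    · refine LinearMap.ext fun φ => funext fun m => ?_
      have := hne m
      simp only [LinearMap.sub_apply, Module.End.mul_apply, Pi.sub_apply, Pi.smul_apply,
        Module.algebraMap_end_apply, seqMul_apply, smul_eq_mul, Module.End.one_apply, ← sub_mul]
      first | exact mul_inv_cancel_left₀ this _ | exact inv_mul_cancel_left₀ this _

theorem aeval_seqMul_apply (f : ℂ[X]) (φ : ℤ → ℂ) (n : ℤ) :
    aeval (seqMul fun n => (n : ℂ)) f φ n = f.eval (n : ℂ) * φ n := by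
  induction f using Polynomial.induction_on' with
  | add p q hp hq => rw [map_add, LinearMap.add_apply, Pi.add_apply, hp, hq, eval_add, add_mul]
  | monomial k c =>
    have : ∀ k : ℕ, ((seqMul fun n => (n : ℂ)) ^ k) φ n = (n : ℂ) ^ k * φ n := fun k => by
      induction k with
      | zero => simp
      | succ k ih => rw [pow_succ', Module.End.mul_apply, seqMul_apply, ih, pow_succ']; ring
    rw [aeval_monomial, Module.End.mul_apply, Module.algebraMap_end_apply, Pi.smul_apply, this,
      eval_monomial, smul_eq_mul, mul_assoc]

theorem seqShift_pow_one (c : ℤ) (j : ℕ) : (seqShift c ^ j) (1 : ℤ → ℂ) = 1 := by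
  induction j with
  | zero => simp
  | succ j ih =>
    rw [pow_succ', Module.End.mul_apply, ih]
    rfl

/-- Applied to the constant sequence `1`, which is fixed by the shift `V`, both sides give the
values of `p` and `q` at all integers. -/
theorem IsF.unique {lam l j : ℕ} {p q : ℂ[X]} (hp : IsF lam l j p) (hq : IsF lam l j q) :
    p = q := by
  have h := (hp _ _ _ _ (isTriple_seq lam)).trans (hq _ _ _ _ (isTriple_seq lam)).symm
  have hone : ∀ n : ℤ, (seqShift (-1) ^ j) (1 : ℤ → ℂ) n = 1 := fun n => by
    rw [seqShift_pow_one, Pi.one_apply]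
  refine Polynomial.eq_of_infinite_eval_eq p q ?_
  refine (Set.infinite_range_of_injective (Int.cast_injective (α := ℂ))).mono ?_
  rintro _ ⟨n, rfl⟩
  have := congrFun (LinearMap.congr_fun h 1) n
  rwa [Module.End.mul_apply, Module.End.mul_apply, aeval_seqMul_apply, aeval_seqMul_apply, hone,
    mul_one, mul_one] at this

/-! ### The matrices of `U`, `V`, `H` -/

theorem rho_u (lam : ℕ) (g : Gen) : rho lam (u g) = genMat lam g := by
  rw [rho, u, RingQuot.liftAlgHom_mkAlgHom_apply, gen, FreeAlgebra.lift_ι_apply]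

theorem bH_eq (lam : ℕ) : bH lam = matH lam := rho_u lam .H

theorem bU_eq (lam : ℕ) : bU lam = matF lam := rho_u lam .F

/-- The matrix of `e_a ↦ c_a e_{a-1}`. -/
def matUp (lam : ℕ) (c : ℕ → ℂ) : Mat lam :=
  Matrix.of fun a b => if (a : ℕ) + 1 = b then c b else 0

theorem matUp_apply (lam : ℕ) (c : ℕ → ℂ) (a b : Fin (2 * lam + 1)) :
    matUp lam c a b = if (a : ℕ) + 1 = b then c b else 0 := rfl

theorem matF_apply (lam : ℕ) (a b : Fin (2 * lam + 1)) :
    matF lam a b = if (a : ℕ) = b + 1 then 1 else 0 := rfl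

theorem matG_eq (lam : ℕ) : matG lam = matUp lam (gCoeff lam) := rfl

/-- The condition on `c` accounts for the missing vector `e_{2 lam + 1}`, so the last diagonal entry
follows the general formula. -/
theorem matUp_mul_matF (lam : ℕ) {c : ℕ → ℂ} (hc : c (2 * lam + 1) = 0) :
    matUp lam c * matF lam = Matrix.diagonal fun a : Fin (2 * lam + 1) => c (a + 1) := by
  ext a b
  rw [Matrix.mul_apply, Matrix.diagonal_apply]
  by_cases h : (a : ℕ) + 1 < 2 * lam + 1
  · rw [Finset.sum_eq_single ⟨(a : ℕ) + 1, h⟩]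
    · simp [matUp_apply, matF_apply, Fin.ext_iff]
    · intro d _ hd
      rw [matUp_apply, if_neg fun h' => hd (Fin.ext h'.symm), zero_mul]
    · simp
  · have ha : (a : ℕ) + 1 = 2 * lam + 1 := by omega
    rw [ha, hc, ite_self]
    refine Finset.sum_eq_zero fun d _ => ?_
    rw [matUp_apply, if_neg (by omega), zero_mul]

theorem matF_mul_matUp (lam : ℕ) {c : ℕ → ℂ} (hc : c 0 = 0) :
    matF lam * matUp lam c = Matrix.diagonal fun a : Fin (2 * lam + 1) => c a := by
  ext a b
  rw [Matrix.mul_apply, Matrix.diagonal_apply]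
  by_cases h : (a : ℕ) = 0
  · rw [h, hc, ite_self]
    refine Finset.sum_eq_zero fun d _ => ?_
    rw [matF_apply, if_neg (by omega), zero_mul]
  · have h1 : (a : ℕ) - 1 + 1 = a := by omega
    rw [Finset.sum_eq_single ⟨(a : ℕ) - 1, by omega⟩]
    · simp only [matUp_apply, matF_apply, h1, Fin.ext_iff, if_true, one_mul]
      split_ifs with h2
      · rw [h2]
      · rfl
    · intro d _ hd
      rw [matF_apply, if_neg fun h' => hd (Fin.ext (by simp; omega)), zero_mul]
    · simp

/-- The coefficient of `V`. -/
noncomputable def vCoeff (lam b : ℕ) : ℂ := (b : ℂ) * (2 * lam + 1 - b) / 2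

/-- Since `τ - H + 1/2 = 1 - 2 F G` and `F G` is diagonal with entries `c_a`, the left side is the
entry of `V`; the two parity cases of `c_a` merge into one quadratic. -/
theorem vCoeff_succ (lam a : ℕ) :
    (1 - 2 * gCoeff lam a) * gCoeff lam (a + 1) = vCoeff lam (a + 1) := by
  obtain ⟨m, rfl | rfl⟩ := Nat.even_or_odd' a
  · have h1 : (2 * m + 1) % 2 ≠ 0 := by omega
    have h2 : (2 * m + 1) / 2 = m := by omega
    have h3 : 2 * m % 2 = 0 := by omega
    have h4 : 2 * m / 2 = m := by omega
    simp only [gCoeff, vCoeff, h1, h2, h3, h4, if_true, if_false]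
    push_cast
    ring
  · have h1 : (2 * m + 1 + 1) % 2 = 0 := by omega
    have h2 : (2 * m + 1) / 2 = m := by omega
    have h3 : (2 * m + 1 + 1) / 2 = m + 1 := by omega
    have h4 : (2 * m + 1) % 2 ≠ 0 := by omega
    simp only [gCoeff, vCoeff, h1, h2, h3, h4, if_true, if_false]
    push_cast
    ring

theorem bV_eq (lam : ℕ) : bV lam = matUp lam (vCoeff lam) := by
  have h0 : gCoeff lam 0 = 0 := by simp [gCoeff]
  have h : bV lam = matG lam - (2 : ℂ) • (matF lam * matG lam * matG lam) := by
    rw [bV, elV, tau]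
    simp only [map_mul, map_sub, map_add, map_smul, rho_u, AlgHom.commutes, genMat]
    rw [show matH lam + algebraMap ℂ (Mat lam) (1 / 2) - (2 : ℂ) • (matF lam * matG lam) - matH lam
      + algebraMap ℂ (Mat lam) (1 / 2)
      = algebraMap ℂ (Mat lam) (1 / 2) + algebraMap ℂ (Mat lam) (1 / 2)
        - (2 : ℂ) • (matF lam * matG lam) by abel, ← map_add, show (1 / 2 + 1 / 2 : ℂ) = 1 by norm_num,
      map_one, sub_mul, one_mul, smul_mul_assoc]
  rw [h]
  nth_rewrite 2 [matG_eq]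
  rw [matF_mul_matUp lam h0, matG_eq]
  ext a b
  rw [Matrix.sub_apply, Matrix.smul_apply, Matrix.diagonal_mul, matUp_apply, matUp_apply]
  split_ifs with hab
  · rw [← hab, ← vCoeff_succ, smul_eq_mul]
    ring
  · simp

theorem vCoeff_zero (lam : ℕ) : vCoeff lam 0 = 0 := by simp [vCoeff]

theorem vCoeff_last (lam : ℕ) : vCoeff lam (2 * lam + 1) = 0 := by simp [vCoeff]

theorem vCoeff_ne_zero {lam b : ℕ} (h0 : b ≠ 0) (h : b < 2 * lam + 1) : vCoeff lam b ≠ 0 := by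
  refine div_ne_zero (mul_ne_zero (by exact_mod_cast h0) fun h' => ?_) two_ne_zero
  have : ((2 * lam + 1 : ℕ) : ℂ) = b := by
    push_cast
    linear_combination h'
  have := Nat.cast_injective this
  omega

theorem diagonal_eq_aeval (lam : ℕ) (p : ℂ[X]) :
    aeval (matH lam) p = Matrix.diagonal fun a : Fin (2 * lam + 1) => p.eval (lam - (a : ℕ) : ℂ) := by
  rw [matH, ← Matrix.diagonalAlgHom_apply (R := ℂ), aeval_algHom_apply, Matrix.diagonalAlgHom_apply]
  congr 1
  funext a
  rw [aeval_pi_apply]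
  exact congrFun (coe_aeval_eq_eval _) p

theorem isTriple_mat (lam : ℕ) : IsTriple lam (bU lam) (bV lam) (bH lam) := by
  rw [bU_eq, bV_eq, bH_eq]
  have hscal : ∀ c : ℂ, algebraMap ℂ (Mat lam) c = Matrix.diagonal fun _ => c := fun c => by
    rw [Matrix.algebraMap_eq_diagonal]
    rfl
  refine ⟨matHF lam, ?_, ?_, ?_, fun n => ?_⟩
  · ext a b
    simp only [matH, Matrix.sub_apply, Matrix.diagonal_mul, Matrix.mul_diagonal, matUp_apply]
    split_ifs with h
    · rw [← h]; push_cast; ring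
    · ring
  · rw [matUp_mul_matF lam (vCoeff_last lam), hscal, pow_two, matH, Matrix.diagonal_mul_diagonal,
      Matrix.diagonal_sub, Matrix.diagonal_add, ← Matrix.diagonal_smul]
    congr 1
    funext a
    simp only [vCoeff, Pi.smul_apply, smul_eq_mul]
    push_cast
    ring
  · rw [matF_mul_matUp lam (vCoeff_zero lam), hscal, pow_two, matH, Matrix.diagonal_mul_diagonal,
      Matrix.diagonal_sub, Matrix.diagonal_sub, ← Matrix.diagonal_smul]
    congr 1
    funext a
    simp only [vCoeff, Pi.smul_apply, smul_eq_mul]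
    ring
  · rw [hscal, matH, Matrix.diagonal_sub, Matrix.isUnit_diagonal, Pi.isUnit_iff]
    intro a
    rw [isUnit_iff_ne_zero]
    intro h
    have : ((2 * (lam - a : ℤ) : ℤ) : ℂ) = (2 * n + 1 : ℤ) := by
      push_cast
      linear_combination 2 * h
    have := Int.cast_injective this
    omega

/-! ### Generation -/

theorem matF_mul_single (lam : ℕ) (a b : Fin (2 * lam + 1)) (h : (a : ℕ) + 1 < 2 * lam + 1) :
    matF lam * Matrix.single a b 1 = Matrix.single ⟨(a : ℕ) + 1, h⟩ b 1 := by
  ext i j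
  by_cases hj : j = b
  · subst hj
    rw [Matrix.mul_single_apply_same, mul_one, matF_apply, Matrix.single_apply]
    simp [Fin.ext_iff, eq_comm]
  · rw [Matrix.mul_single_apply_of_ne _ _ _ _ _ hj, Matrix.single_apply, if_neg]
    exact fun h' => hj h'.2.symm

theorem single_mul_matUp (lam : ℕ) (c : ℕ → ℂ) (a b : Fin (2 * lam + 1))
    (h : (b : ℕ) + 1 < 2 * lam + 1) :
    Matrix.single a b 1 * matUp lam c = c (b + 1) • Matrix.single a ⟨(b : ℕ) + 1, h⟩ 1 := by
  ext i j
  rw [Matrix.smul_apply]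
  by_cases hi : i = a
  · subst hi
    rw [Matrix.single_mul_apply_same, one_mul, matUp_apply, Matrix.single_apply]
    by_cases hj : (b : ℕ) + 1 = j
    · simp [hj]
    · simp [Fin.ext_iff, hj]
  · rw [Matrix.single_mul_apply_of_ne _ _ _ _ _ hi, Matrix.single_apply, if_neg, smul_zero]
    exact fun h' => hi h'.1.symm

theorem exists_aeval_matH_eq_single (lam : ℕ) (a : Fin (2 * lam + 1)) :
    ∃ p : ℂ[X], aeval (matH lam) p = Matrix.single a a 1 := by
  have hinj : Function.Injective fun b : Fin (2 * lam + 1) => (lam - (b : ℕ) : ℂ) := by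
    intro b c h
    exact Fin.ext (Nat.cast_injective (sub_right_injective h))
  refine ⟨Lagrange.basis Finset.univ (fun b : Fin (2 * lam + 1) => (lam - (b : ℕ) : ℂ)) a, ?_⟩
  rw [diagonal_eq_aeval, ← Matrix.diagonal_single]
  congr 1
  funext b
  by_cases h : b = a
  · subst h
    rw [Lagrange.eval_basis_self hinj.injOn (Finset.mem_univ _), Pi.single_eq_same]
  · rw [Pi.single_eq_of_ne h]
    exact Lagrange.eval_basis_of_ne (v := fun b : Fin (2 * lam + 1) => (lam - (b : ℕ) : ℂ))
      (Ne.symm h) (Finset.mem_univ b)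

/-- The eigenvalues of `H` are distinct, so Lagrange interpolation gives the matrix unit at `(0,
0)`. Right multiplication by `V` moves its column, left multiplication by `U` its row, and all
matrix units are reached. -/
theorem adjoin_eq_top (lam : ℕ) : Algebra.adjoin ℂ {bU lam, bV lam, bH lam} = ⊤ := by
  rw [bU_eq, bV_eq, bH_eq]
  set S := Algebra.adjoin ℂ {matF lam, matUp lam (vCoeff lam), matH lam} with hS
  have hF : matF lam ∈ S := Algebra.subset_adjoin (by simp)
  have hV : matUp lam (vCoeff lam) ∈ S := Algebra.subset_adjoin (by simp)
  have h00 : Matrix.single (0 : Fin (2 * lam + 1)) 0 (1 : ℂ) ∈ S := by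
    obtain ⟨p, hp⟩ := exists_aeval_matH_eq_single lam 0
    rw [← hp]
    exact Algebra.adjoin_mono (by simp) (aeval_mem_adjoin_singleton ℂ (matH lam))
  have h0 : ∀ n (h : n < 2 * lam + 1), Matrix.single (0 : Fin (2 * lam + 1)) ⟨n, h⟩ (1 : ℂ) ∈ S := by
    intro n
    induction n with
    | zero => exact fun _ => h00
    | succ n ih =>
      intro h
      have h1 := S.mul_mem (ih (by omega)) hV
      rw [single_mul_matUp lam _ _ _ h] at h1
      have h2 := S.smul_mem h1 (vCoeff lam (n + 1))⁻¹
      rwa [smul_smul, inv_mul_cancel₀ (vCoeff_ne_zero n.succ_ne_zero h), one_smul] at h2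
  have hab : ∀ n (h : n < 2 * lam + 1) (b : Fin (2 * lam + 1)),
      Matrix.single (⟨n, h⟩ : Fin (2 * lam + 1)) b (1 : ℂ) ∈ S := by
    intro n
    induction n with
    | zero => exact fun _ b => h0 b b.2
    | succ n ih =>
      intro h b
      have h1 := S.mul_mem hF (ih (by omega) b)
      rwa [matF_mul_single lam _ _ h] at h1
  refine eq_top_iff.2 fun M _ => ?_
  rw [Matrix.matrix_eq_sum_single M]
  refine sum_mem fun a _ => sum_mem fun b _ => ?_
  have := S.smul_mem (hab a a.2 b) (M a b)
  rwa [Matrix.smul_single, smul_eq_mul, mul_one] at this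

theorem rho_surjective (lam : ℕ) : Function.Surjective (rho lam) := by
  rw [← AlgHom.range_eq_top, eq_top_iff, ← adjoin_eq_top, Algebra.adjoin_le_iff]
  rintro _ (rfl | rfl | rfl) <;> exact ⟨_, rfl⟩

/-! ### Parity and supertransposition -/

theorem isHomog_matUp (lam : ℕ) (c : ℕ → ℂ) : IsHomog 1 (matUp lam c) := by
  intro a b h
  rw [matUp_apply] at h
  have := (ite_ne_right_iff.1 h).1
  omega

theorem isHomog_matF (lam : ℕ) : IsHomog 1 (matF lam) := by
  intro a b h
  rw [matF_apply] at h
  have := (ite_ne_right_iff.1 h).1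
  omega

theorem isHomog_diagonal {lam : ℕ} (d : Fin (2 * lam + 1) → ℂ) :
    IsHomog 0 (Matrix.diagonal d : Mat lam) := by
  intro a b h
  rw [Matrix.diagonal_apply] at h
  have := congrArg Fin.val (ite_ne_right_iff.1 h).1
  omega

theorem IsHomog.mul {lam p q : ℕ} {M N : Mat lam} (hM : IsHomog p M) (hN : IsHomog q N) :
    IsHomog (p + q) (M * N) := by
  intro a b h
  rw [Matrix.mul_apply] at h
  obtain ⟨c, -, hc⟩ := Finset.exists_ne_zero_of_sum_ne_zero h
  have h1 := hM a c (left_ne_zero_of_mul hc)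
  have h2 := hN c b (right_ne_zero_of_mul hc)
  omega

theorem IsHomog.pow {lam : ℕ} {M : Mat lam} (hM : IsHomog 1 M) (n : ℕ) : IsHomog n (M ^ n) := by
  induction n with
  | zero =>
    rw [pow_zero, ← Matrix.diagonal_one]
    exact isHomog_diagonal _
  | succ n ih =>
    rw [pow_succ]
    exact ih.mul hM

theorem scale_succ (lam a : ℕ) :
    scale lam (a + 1) = scale lam a * ((-1) ^ (a + 1) / vCoeff lam (a + 1)) := by
  rw [scale, Finset.prod_Icc_succ_top (by omega), ← scale, vCoeff]

theorem scale_ne_zero {lam a : ℕ} (h : a < 2 * lam + 1) : scale lam a ≠ 0 := by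
  induction a with
  | zero => simp [scale]
  | succ a ih =>
    rw [scale_succ]
    exact mul_ne_zero (ih (by omega))
      (div_ne_zero (pow_ne_zero _ (by norm_num)) (vCoeff_ne_zero a.succ_ne_zero h))

theorem st_apply {lam : ℕ} (M : Mat lam) (b a : Fin (2 * lam + 1)) :
    st M b a = (-1 : ℂ) ^ ((b : ℕ) * ((a : ℕ) + b)) * (scale lam b / scale lam a) * M a b := rfl

theorem st_mul {lam p q : ℕ} {v w : Mat lam} (hv : IsHomog p v) (hw : IsHomog q w) :
    st (v * w) = (-1 : ℂ) ^ (p * q) • (st w * st v) := by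
  ext b a
  rw [st_apply, Matrix.smul_apply, Matrix.mul_apply, Matrix.mul_apply, Finset.mul_sum, smul_eq_mul,
    Finset.mul_sum]
  refine Finset.sum_congr rfl fun c _ => ?_
  by_cases hvc : v a c = 0
  · simp [st_apply, hvc]
  by_cases hwc : w c b = 0
  · simp [st_apply, hwc]
  have h1 := hv a c hvc
  have h2 := hw c b hwc
  have hc := scale_ne_zero c.2
  have ha := scale_ne_zero a.2
  -- When both entries are nonzero, `p` and `q` are `a + c` and `c + b` modulo two, so the sign
  -- identity depends only on the parities of `a, b, c`.
  have hsign : (-1 : ℂ) ^ ((b : ℕ) * ((a : ℕ) + b))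
      = (-1) ^ (p * q) * ((-1) ^ ((b : ℕ) * (c + b)) * (-1) ^ ((c : ℕ) * (a + c))) := by
    rw [← pow_add, ← pow_add]
    refine neg_one_pow_congr ?_
    have h1' : (Even (a : ℕ) ↔ Even (c : ℕ)) ↔ Even p := by
      rw [← Nat.even_add, Nat.even_iff, Nat.even_iff, h1]
    have h2' : (Even (c : ℕ) ↔ Even (b : ℕ)) ↔ Even q := by
      rw [← Nat.even_add, Nat.even_iff, Nat.even_iff, h2]
    simp only [Nat.even_add, Nat.even_mul, ← h1', ← h2']
    by_cases ea : Even (a : ℕ) <;> by_cases eb : Even (b : ℕ) <;> by_cases ec : Even (c : ℕ) <;>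
      simp only [ea, eb, ec, iff_true, iff_false, or_true, or_false, or_self, iff_self,
        not_true_eq_false]
  rw [st_apply, st_apply, hsign]
  field_simp

theorem st_diagonal {lam : ℕ} (d : Fin (2 * lam + 1) → ℂ) :
    st (Matrix.diagonal d : Mat lam) = Matrix.diagonal d := by
  ext b a
  rw [st_apply, Matrix.diagonal_apply, Matrix.diagonal_apply]
  by_cases h : a = b
  · subst h
    rw [div_self (scale_ne_zero a.2), ← two_mul, mul_left_comm, pow_mul,
      neg_one_sq, one_pow, one_mul, one_mul]
  · rw [if_neg h, if_neg (Ne.symm h), mul_zero]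

theorem st_matF (lam : ℕ) : st (matF lam) = -matUp lam (vCoeff lam) := by
  ext b a
  rw [st_apply, matF_apply, Matrix.neg_apply, matUp_apply]
  by_cases h : (a : ℕ) = b + 1
  · have ha := a.2
    rw [h] at ha
    have hv := vCoeff_ne_zero (Nat.succ_ne_zero (b : ℕ)) ha
    have hs := scale_ne_zero (lam := lam) (a := b) (by omega)
    rw [if_pos h, if_pos h.symm, h, scale_succ]
    have e1 : (-1 : ℂ) ^ ((b : ℕ) * (b + 1 + b)) = (-1) ^ (b : ℕ) := by
      refine neg_one_pow_congr ?_
      simp only [Nat.even_mul, Nat.even_add, Nat.even_add_one]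
      tauto
    rw [e1, pow_succ]
    field_simp
  · rw [if_neg h, if_neg fun h' => h h'.symm]
    simp

theorem st_matUp (lam : ℕ) : st (matUp lam (vCoeff lam)) = matF lam := by
  ext b a
  rw [st_apply, matF_apply, matUp_apply]
  by_cases h : (b : ℕ) = a + 1
  · have hb := b.2
    rw [h] at hb
    have hv := vCoeff_ne_zero (Nat.succ_ne_zero (a : ℕ)) hb
    have hs := scale_ne_zero (lam := lam) (a := a) (by omega)
    rw [if_pos h, if_pos h.symm, h, scale_succ]
    have e1 : (-1 : ℂ) ^ (((a : ℕ) + 1) * (a + (a + 1))) = (-1) ^ ((a : ℕ) + 1) := by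
      refine neg_one_pow_congr ?_
      simp only [Nat.even_mul, Nat.even_add, Nat.even_add_one]
      tauto
    have e2 : (-1 : ℂ) ^ ((a : ℕ) + 1) * (-1) ^ ((a : ℕ) + 1) = 1 := by rw [← mul_pow]; norm_num
    rw [e1]
    field_simp
    linear_combination e2
  · rw [if_neg h, if_neg fun h' => h h'.symm]
    simp

/-- An element of weight `i` is supported on the diagonal `b - a = i`, and the diagonal entries of
`v wᵗ` involve only products of equally placed entries of `v` and `w`. -/
theorem form_eq_zero_of_isWeight {lam : ℕ} {i j : ℤ} {v w : Mat lam} (hij : i ≠ j)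
    (hv : IsWeight lam i v) (hw : IsWeight lam j w) : form v w = 0 := by
  have key : ∀ (i : ℤ) (v : Mat lam), IsWeight lam i v → ∀ a b, v a b ≠ 0 → (b : ℤ) - a = i := by
    intro i v hv a b h
    have := congrFun (congrFun hv a) b
    rw [bH_eq, matH, Matrix.sub_apply, Matrix.diagonal_mul, Matrix.mul_diagonal,
      Matrix.smul_apply, smul_eq_mul] at this
    have h2 : ((b - a : ℤ) : ℂ) = i := by
      push_cast
      refine mul_right_cancel₀ h ?_
      linear_combination this
    exact Int.cast_injective h2
  rw [form, str]
  refine Finset.sum_eq_zero fun a _ => ?_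
  rw [Matrix.mul_apply, Finset.sum_eq_zero, mul_zero]
  intro b _
  rw [st_apply]
  by_cases h1 : v a b = 0
  · rw [h1, zero_mul]
  by_cases h2 : w a b = 0
  · rw [h2, mul_zero, mul_zero]
  exact absurd ((key i v hv a b h1).symm.trans (key j w hw a b h2)) hij

/-! ### The form on polynomials -/

/-- The exact sign is never needed: `e' ^ 2 = 1` already makes it a nonzero factor of the form. -/
theorem st_pow_of_st {lam : ℕ} {M N : Mat lam} (hM : IsHomog 1 M) {e : ℂ} (he : e ^ 2 = 1)
    (h : st M = e • N) (j : ℕ) : ∃ e' : ℂ, e' ^ 2 = 1 ∧ st (M ^ j) = e' • N ^ j := by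
  induction j with
  | zero =>
    refine ⟨1, one_pow 2, ?_⟩
    rw [pow_zero, pow_zero, one_smul, ← Matrix.diagonal_one, st_diagonal]
  | succ j ih =>
    obtain ⟨e', he', hj⟩ := ih
    refine ⟨(-1) ^ (j * 1) * (e * e'), ?_, ?_⟩
    · rw [mul_pow, mul_pow, he, he', ← pow_mul, mul_comm (j * 1), pow_mul, neg_one_sq, one_pow,
        one_mul, one_mul]
    · rw [pow_succ, st_mul (hM.pow j) hM, h, hj, smul_mul_smul_comm, smul_smul, ← pow_succ']

theorem str_aeval (lam : ℕ) (p : ℂ[X]) :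
    str (aeval (matH lam) p)
      = ∑ a ∈ Finset.range (2 * lam + 1), (-1) ^ a * p.eval (lam - a : ℂ) := by
  rw [str, diagonal_eq_aeval, ← Fin.sum_univ_eq_sum_range (fun a => (-1) ^ a * p.eval (lam - a : ℂ))]
  simp

/-- Polynomials in `H` are even and fixed by `st`, so the product under the supertrace collapses to
`e` times `(f g P)(H)`. -/
theorem form_aeval_mul {lam : ℕ} {M N : Mat lam} {j : ℕ} {e : ℂ} (hM : IsHomog j M)
    (h : st M = e • N) {P : ℂ[X]} (hP : M * N = aeval (matH lam) P) (f g : ℂ[X]) :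
    form (aeval (matH lam) f * M) (aeval (matH lam) g * M)
      = e * ∑ a ∈ Finset.range (2 * lam + 1),
        (-1) ^ a * ((f * g).eval (lam - a : ℂ) * P.eval (lam - a : ℂ)) := by
  have hg : st (aeval (matH lam) g) = aeval (matH lam) g := by
    rw [diagonal_eq_aeval, st_diagonal]
  have hh : IsHomog 0 (aeval (matH lam) g) := by
    rw [diagonal_eq_aeval]
    exact isHomog_diagonal _
  have : aeval (matH lam) f * M * st (aeval (matH lam) g * M)
      = e • aeval (matH lam) (f * g * P) := by
    rw [st_mul hh hM, hg, h, zero_mul, pow_zero, one_smul, smul_mul_assoc, mul_smul_comm,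
      mul_assoc, ← mul_assoc M, hP, ← map_mul, ← map_mul]
    congr 2
    ring
  have hsmul : ∀ (c : ℂ) (M : Mat lam), str (c • M) = c * str M := fun c M => by
    simp only [str, Matrix.smul_apply, smul_eq_mul, Finset.mul_sum]
    refine Finset.sum_congr rfl fun a _ => ?_
    ring
  rw [form, this, hsmul, str_aeval]
  simp only [eval_mul]

namespace IsTriple

variable {A : Type} [Ring A] [Algebra ℂ A] {lam : ℕ} {U V H : A}

theorem exists_V_pow_mul_U_pow (T : IsTriple lam U V H) (j : ℕ) :
    ∃ P : ℂ[X], V ^ j * U ^ j = aeval H P ∧ ∀ x, P.eval x = weight lam j x := by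
  induction j with
  | zero => exact ⟨1, by simp, by simp [weight]⟩
  | succ j ih =>
    obtain ⟨P, hP, hx⟩ := ih
    refine ⟨P * ((wPoly lam).comp (X + C (-1))).comp (X + C (-(j : ℂ))), ?_, fun x => ?_⟩
    · rw [pow_succ, pow_succ', mul_assoc, ← mul_assoc V, T.V_mul_U, ← mul_assoc, T.V_pow_mul_aeval,
        mul_assoc, hP, ← map_mul, mul_comm]
    · rw [eval_mul, hx, weight_succ]
      simp only [eval_comp, eval_add, eval_X, eval_C]
      congr 2
      ring

theorem U_pow_mul_aeval (T : IsTriple lam U V H) (m : ℕ) (f : ℂ[X]) :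
    U ^ m * aeval H f = aeval H (f.comp (X + C (m : ℂ))) * U ^ m := by
  induction m with
  | zero => simp
  | succ m ih =>
    rw [pow_succ', mul_assoc, ih, ← mul_assoc, T.U_mul_aeval, mul_assoc, comp_assoc]
    congr 3
    simp
    ring

theorem exists_U_pow_mul_V_pow (T : IsTriple lam U V H) (j : ℕ) :
    ∃ P : ℂ[X], U ^ j * V ^ j = aeval H P ∧ ∀ x, P.eval x = weight lam j (-x) := by
  induction j with
  | zero => exact ⟨1, by simp, by simp [weight]⟩
  | succ j ih =>
    obtain ⟨P, hP, hx⟩ := ih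
    refine ⟨P * (wPoly lam).comp (X + C (j : ℂ)), ?_, fun x => ?_⟩
    · rw [pow_succ, pow_succ', mul_assoc, ← mul_assoc U, T.U_mul_V, ← mul_assoc, T.U_pow_mul_aeval,
        mul_assoc, hP, ← map_mul, mul_comm]
    · rw [eval_mul, hx, weight_succ]
      simp only [eval_comp, eval_add, eval_X, eval_C]
      rw [eval_wPoly_neg lam (x := x + j) (y := -x - (j + 1)) (by ring)]

end IsTriple

theorem exists_polyForm_natCast (lam j : ℕ) :
    ∃ e : ℂ, e ≠ 0 ∧ ∀ f g : ℂ[X], polyForm lam j f g = e * altSum lam j (f * g) := by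
  obtain ⟨P, hP, hx⟩ := (isTriple_mat lam).exists_V_pow_mul_U_pow j
  rw [bU_eq, bV_eq, bH_eq] at hP
  obtain ⟨e, he, hst⟩ := st_pow_of_st (isHomog_matUp lam (vCoeff lam)) (one_pow 2)
    ((st_matUp lam).trans (one_smul ℂ _).symm) j
  refine ⟨e, fun h => by simp [h] at he, fun f g => ?_⟩
  have hpw : pw lam j = matUp lam (vCoeff lam) ^ j := by simp [pw, bV_eq]
  rw [polyForm, hpw, bH_eq, form_aeval_mul ((isHomog_matUp lam _).pow j) hst hP, altSum]
  simp only [hx]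

theorem exists_polyForm_neg_natCast (lam j : ℕ) :
    ∃ e : ℂ, e ≠ 0 ∧ ∀ f g : ℂ[X],
      polyForm lam (-(j : ℤ)) (refl f) (refl g) = e * altSum lam j (f * g) := by
  obtain ⟨P, hP, hx⟩ := (isTriple_mat lam).exists_U_pow_mul_V_pow j
  rw [bU_eq, bV_eq, bH_eq] at hP
  obtain ⟨e, he, hst⟩ := st_pow_of_st (isHomog_matF lam) (e := -1) (by norm_num)
    ((st_matF lam).trans (neg_one_smul ℂ _).symm) j
  refine ⟨e, fun h => by simp [h] at he, fun f g => ?_⟩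
  have hpw : pw lam (-(j : ℤ)) = matF lam ^ j := by
    cases j with
    | zero => simp [pw]
    | succ j => rw [pw, if_neg (by omega), bU_eq]; simp
  -- The spectrum of `H` is symmetric under `x ↦ -x`; reversing the sum cancels both the reflection
  -- of `f`, `g` and that in the value `weight lam j (-x)` of `U^j V^j`.
  rw [polyForm, hpw, bH_eq, form_aeval_mul ((isHomog_matF lam).pow j) hst hP, altSum,
    ← Finset.sum_range_reflect]
  congr 1
  refine Finset.sum_congr rfl fun a ha => ?_
  have ha' := Finset.mem_range.1 ha
  have hcast : (lam : ℂ) - (2 * lam + 1 - 1 - a : ℕ) = -(lam - a) := by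
    rw [Nat.add_sub_cancel, Nat.cast_sub (by omega)]
    push_cast
    ring
  have hsign : (-1 : ℂ) ^ (2 * lam + 1 - 1 - a) = (-1) ^ a := by
    refine neg_one_pow_congr ?_
    rw [Nat.even_iff, Nat.even_iff]
    omega
  rw [hcast, hsign, hx, neg_neg]
  simp [refl]

/-! ### Remaining structural facts and assembly -/

theorem rho_F_homog (lam : ℕ) : IsHomog 1 (rho lam (u .F)) := by
  rw [rho_u]
  exact isHomog_matF lam

theorem rho_G_homog (lam : ℕ) : IsHomog 1 (rho lam (u .G)) := by
  rw [rho_u]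
  exact isHomog_matUp lam _

theorem bH_homog (lam : ℕ) : IsHomog 0 (bH lam) := by
  rw [bH_eq]
  exact isHomog_diagonal _

theorem rho_G_mulVec (lam : ℕ) : (rho lam (u .G)).mulVec (Pi.single 0 1) = 0 := by
  rw [rho_u]
  funext a
  rw [Matrix.mulVec_single_one]
  simp [genMat, matG]

theorem bH_mulVec (lam : ℕ) :
    (bH lam).mulVec (Pi.single 0 1) = (lam : ℂ) • Pi.single 0 1 := by
  rw [bH_eq, matH, Matrix.diagonal_mulVec_single, ← Pi.single_smul]
  simp

theorem st_bH (lam : ℕ) : st (bH lam) = bH lam := by rw [bH_eq, matH, st_diagonal]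

theorem st_bU (lam : ℕ) : st (bU lam) = -bV lam := by rw [bU_eq, bV_eq, st_matF]

theorem st_bV (lam : ℕ) : st (bV lam) = bU lam := by rw [bU_eq, bV_eq, st_matUp]

theorem refl_refl (f : ℂ[X]) : refl (refl f) = f := comp_neg_X_comp_neg_X f

theorem degree_refl (f : ℂ[X]) : (refl f).degree = f.degree := degree_comp_neg_X

theorem even_index (lam i : ℕ) :
    IsOrthogonalPolys (polyForm lam (2 * i)) (fun l => fPoly lam l (2 * i)) ∧
      ∀ l : ℕ, polyForm lam (2 * i) (fPoly lam l (2 * i)) (fPoly lam l (2 * i)) ≠ 0 ↔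
        l + 2 * i ≤ 2 * lam := by
  obtain ⟨e, he, h⟩ := exists_polyForm_natCast lam (2 * i)
  push_cast at h
  refine ⟨fun l => ⟨degree_fPoly_even lam l i, fun g hg => ?_⟩, fun l => ?_⟩
  · have h0 := altSum_fPoly_mul_eq_zero lam i hg
    rw [h, h, mul_comm g, h0, mul_zero]
    exact ⟨rfl, rfl⟩
  · rw [h, mul_ne_zero_iff, and_iff_right he, altSum_fPoly_sq_ne_zero_iff]

theorem even_index_neg (lam i : ℕ) :
    IsOrthogonalPolys (polyForm lam (-(2 * i))) (fun l => refl (fPoly lam l (2 * i))) ∧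
      ∀ l : ℕ, polyForm lam (-(2 * i)) (refl (fPoly lam l (2 * i))) (refl (fPoly lam l (2 * i))) ≠ 0 ↔
        l + 2 * i ≤ 2 * lam := by
  obtain ⟨e, he, h⟩ := exists_polyForm_neg_natCast lam (2 * i)
  push_cast at h
  refine ⟨fun l => ⟨(degree_refl _).trans (degree_fPoly_even lam l i), fun g hg => ?_⟩, fun l => ?_⟩
  · rw [← degree_refl] at hg
    have h0 := altSum_fPoly_mul_eq_zero lam i hg
    rw [← refl_refl g, h, h, mul_comm (refl g), h0, mul_zero]
    exact ⟨rfl, rfl⟩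
  · rw [h, mul_ne_zero_iff, and_iff_right he, altSum_fPoly_sq_ne_zero_iff]

theorem odd_index (lam i l m : ℕ) :
    polyForm lam (2 * i + 1) (fPoly lam l (2 * i + 1)) (fPoly lam m (2 * i + 1)) ≠ 0 ↔
      ∃ k : ℕ, ({l, m} : Set ℕ) = {2 * k, 2 * k + 1} ∧ k + i + 1 ≤ lam := by
  obtain ⟨e, he, h⟩ := exists_polyForm_natCast lam (2 * i + 1)
  push_cast at h
  rw [h, mul_ne_zero_iff, and_iff_right he, altSum_fPoly_odd_ne_zero_iff]

theorem odd_index_neg (lam i l m : ℕ) :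
    polyForm lam (-(2 * i + 1)) (refl (fPoly lam l (2 * i + 1))) (refl (fPoly lam m (2 * i + 1))) ≠ 0 ↔
      ∃ k : ℕ, ({l, m} : Set ℕ) = {2 * k, 2 * k + 1} ∧ k + i + 1 ≤ lam := by
  obtain ⟨e, he, h⟩ := exists_polyForm_neg_natCast lam (2 * i + 1)
  rw [Nat.cast_add, Nat.cast_mul, Nat.cast_two, Nat.cast_one] at h
  rw [h, mul_ne_zero_iff, and_iff_right he, altSum_fPoly_odd_ne_zero_iff]

theorem evenEigen_fPoly (lam k i : ℕ) : EvenEigen lam i 0 (2 * k) (fPoly lam (2 * k) (2 * i)) := by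
  cases k with
  | zero =>
    rw [mul_zero, fPoly_zero_even]
    intro x
    simp
  | succ k =>
    rw [show 2 * (k + 1) = 2 * k + 2 from rfl, fPoly_even_even,
      show (2 * (k + 1 : ℕ) : ℂ) = 2 * k + 2 by push_cast; ring]
    exact evenEigen_brPoly_one lam k i

theorem fPoly_eq_brPoly {k : ℕ} (lam i : ℕ) (hk : 1 ≤ k) :
    fPoly lam (2 * k) (2 * i) = brPoly lam 1 (k - 1) i := by
  obtain ⟨k, rfl⟩ := Nat.exists_eq_add_of_le' hk
  exact fPoly_even_even lam k i

end OspOneTwo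

theorem theorem2p4 (lam : ℕ) :
    -- the image of `U(osp(1|2))` is `Mat(lam+1|lam)`, with highest weight `lam`
    Function.Surjective (rho lam) ∧
    (IsHomog 1 (rho lam (u .F)) ∧ IsHomog 1 (rho lam (u .G)) ∧ IsHomog 0 (bH lam)) ∧
    (rho lam (u .G)).mulVec (Pi.single 0 1) = 0 ∧
    (bH lam).mulVec (Pi.single 0 1) = (lam : ℂ) • Pi.single 0 1 ∧
    -- `U`, `V`, `H` generate this algebra and satisfy the relations
    Algebra.adjoin ℂ {bU lam, bV lam, bH lam} = ⊤ ∧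
    IsTriple lam (bU lam) (bV lam) (bH lam) ∧
    -- the supertransposition
    (∀ (p q : ℕ) (v w : Mat lam), IsHomog p v → IsHomog q w →
      st (v * w) = (-1 : ℂ) ^ (p * q) • (st w * st v)) ∧
    (st (bH lam) = bH lam ∧ st (bU lam) = -bV lam ∧ st (bV lam) = bU lam) ∧
    -- distinct weight components are orthogonal
    (∀ (i j : ℤ) (v w : Mat lam), i ≠ j → IsWeight lam i v → IsWeight lam j w → form v w = 0) ∧
    -- the polynomials `f_{l, j}` are well defined
    (∀ l j : ℕ, ∃! p : ℂ[X], IsF lam l j p) ∧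
    ∀ f : ℕ → ℕ → ℂ[X], (∀ l j, IsF lam l j (f l j)) →
      -- `f_{l, 2i}`: orthogonal polynomials for the form of index `2i`
      (∀ i : ℕ, IsOrthogonalPolys (polyForm lam (2 * i)) (fun l => f l (2 * i)) ∧
        ∀ l : ℕ, polyForm lam (2 * i) (f l (2 * i)) (f l (2 * i)) ≠ 0 ↔ l + 2 * i ≤ 2 * lam) ∧
      -- difference equation, even degree
      (∀ (k i : ℕ) (z : ℂ), 2 * z - 2 * i + 1 ≠ 0 → 2 * z - 2 * i - 1 ≠ 0 →
        (z - lam) * (z + lam + 1) / (2 * z - 2 * i + 1) * (fwd (f (2 * k) (2 * i))).eval z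
          + (z - 2 * i - lam - 1) * (z - 2 * i + lam) / (2 * z - 2 * i - 1)
            * (bwd (f (2 * k) (2 * i))).eval z
          = 2 * k * (f (2 * k) (2 * i)).eval z) ∧
      -- difference equation, odd degree
      (∀ (k i : ℕ) (z : ℂ), 2 * z - 2 * i + 1 ≠ 0 → 2 * z - 2 * i - 1 ≠ 0 →
        (z - lam) * (z + lam + 1) / (2 * z - 2 * i + 1) * (fwd (f (2 * k + 1) (2 * i))).eval z
          + (z - 2 * i - lam - 1) * (z - 2 * i + lam) / (2 * z - 2 * i - 1)
            * (bwd (f (2 * k + 1) (2 * i))).eval z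
          + ((lam + 1 / 2) ^ 2 - (i : ℂ) ^ 2) / ((z - i) ^ 2 - 1 / 4)
            * (f (2 * k + 1) (2 * i)).eval z
          = (2 * k + 1) * (f (2 * k + 1) (2 * i)).eval z) ∧
      -- `f_{l, 2i}(-H)`: orthogonal polynomials for the form of index `-2i`
      (∀ i : ℕ, IsOrthogonalPolys (polyForm lam (-(2 * i))) (fun l => refl (f l (2 * i))) ∧
        ∀ l : ℕ, polyForm lam (-(2 * i)) (refl (f l (2 * i))) (refl (f l (2 * i))) ≠ 0 ↔
          l + 2 * i ≤ 2 * lam) ∧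
      -- odd index: degrees and pairings
      (∀ i : ℕ, (∀ l : ℕ, (f l (2 * i + 1)).degree = l) ∧
        ∀ l m : ℕ, polyForm lam (2 * i + 1) (f l (2 * i + 1)) (f m (2 * i + 1)) ≠ 0 ↔
          ∃ k : ℕ, ({l, m} : Set ℕ) = {2 * k, 2 * k + 1} ∧ k + i + 1 ≤ lam) ∧
      -- odd index, reflected: degrees and pairings
      (∀ i : ℕ, (∀ l : ℕ, (refl (f l (2 * i + 1))).degree = l) ∧
        ∀ l m : ℕ,
          polyForm lam (-(2 * i + 1)) (refl (f l (2 * i + 1))) (refl (f m (2 * i + 1))) ≠ 0 ↔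
          ∃ k : ℕ, ({l, m} : Set ℕ) = {2 * k, 2 * k + 1} ∧ k + i + 1 ≤ lam) ∧
      -- difference equation for `f_{2k, 2i+1}`
      (∀ (k i : ℕ) (z : ℂ), 2 * z - 2 * i - 1 ≠ 0 →
        (z - lam) * (z + lam + 1) / (2 * z - 2 * i - 1) * (fwd (f (2 * k) (2 * i + 1))).eval z
          + (z - 2 * i - 1 + lam) * (z - 2 * i - 2 - lam) / (2 * z - 2 * i - 1)
            * (bwd (f (2 * k) (2 * i + 1))).eval z
          = 2 * k * (f (2 * k) (2 * i + 1)).eval z) ∧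
      -- dual Hahn form; the last version has the lower parameters cleared
      (∀ i : ℕ, f 0 (2 * i) = 1) ∧
      (∀ (k i : ℕ) (z : ℂ), 1 ≤ k → k + i ≤ lam →
        (f (2 * k) (2 * i)).eval z =
          -(poch (2 * i + k + 1) (k - 1) * poch (lam + i + 1) k * poch (i - lam) k)
            * hyp3F2 (-k) (i - z) (z - i) (lam + i + 1) (i - lam) 1) ∧
      (∀ (k i : ℕ) (z : ℂ), 1 ≤ k →
        (f (2 * k) (2 * i)).eval z =
          -(poch (2 * i + k + 1) (k - 1)
            * ∑ n ∈ Finset.range (k + 1), poch (-k) n * poch (i - z) n * poch (z - i) n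
              / (n.factorial : ℂ) * poch (lam + i + 1 + n) (k - n) * poch (i - lam + n) (k - n))) := by

  refine ⟨rho_surjective lam, ⟨rho_F_homog lam, rho_G_homog lam, bH_homog lam⟩, rho_G_mulVec lam,
    bH_mulVec lam, adjoin_eq_top lam, isTriple_mat lam, fun p q v w hv hw => st_mul hv hw,
    ⟨st_bH lam, st_bU lam, st_bV lam⟩, fun i j v w hij hv hw => form_eq_zero_of_isWeight hij hv hw,
    fun l j => ⟨fPoly lam l j, isF_fPoly lam l j, fun p hp => hp.unique (isF_fPoly lam l j)⟩,
    fun f hf => ?_⟩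
  -- Uniqueness identifies any admissible family with the explicit one.
  obtain rfl : f = fPoly lam := funext fun l => funext fun j => (hf l j).unique (isF_fPoly lam l j)
  refine ⟨even_index lam, fun k i z h1 h2 => ?_, fun k i z h1 h2 => ?_, even_index_neg lam,
    fun i => ⟨fun l => degree_fPoly_odd lam l i, fun l m => odd_index lam i l m⟩,
    fun i => ⟨fun l => (degree_refl _).trans (degree_fPoly_odd lam l i),
      fun l m => odd_index_neg lam i l m⟩,
    fun k i z h1 => ?_, fPoly_zero_even lam, fun k i z hk h => ?_, fun k i z hk => ?_⟩
  · have := (evenEigen_fPoly lam k i).difference_equation h1 h2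
    rwa [zero_div, zero_mul, add_zero] at this
  · rw [fPoly_odd_even]
    exact (evenEigen_brPoly_neg_one lam k i).difference_equation h1 h2
  · rw [fPoly_even_odd]
    exact (oddEigen_quo_one lam k i).difference_equation h1
  · rw [fPoly_eq_brPoly lam i hk, eval_brPoly_one_hyp i z hk h]
  · rw [fPoly_eq_brPoly lam i hk, eval_brPoly_one lam i z hk]
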